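/- **Setting.** Let $1/2<\alpha<1$ and let $M_1,M_2$ be positive integers. In a half-line open TASEP every site $x\in\{1,2,3,\dots\}$ carries a colour from $\{1,2,+\infty\}$ ($1$: first class particle, $2$: second class particle, $+\infty$: hole). For every $x\ge 1$, the colours $i$ at $x$ and $j$ at $x+1$ are exchanged at rate $1$ if $i<j$; if the colour at site $1$ is larger than $1$, it is replaced by $1$ at rate $\alpha$. Consider three such processes: * $\eta^{\rm step}_t$ starts with holes everywhere (colours $1,+\infty$ only); * $\eta_t$ starts with one second class particle at $M_1+1$, first class particles on $[M_1+2,M_1+M_2+1]$ and holes elsewhere; let $f(t)$ be the position of the second class particle, and write $f(t)>0$ if it is still on the half-line at time $t$; * $\tilde\eta_t$ starts with second class particles on $[M_1+1,M_1+M_2+1]$ and holes elsewhere; let $\mathbf N_2(1,t)$ be the number of second class particles of $\tilde\eta_t$ at sites $\ge 1$. **The measure $\mu^\alpha_{1/2}$.** This is the probability measure on $\{0,1\}^{\mathbb N}$ ($1$: particle, $0$: hole) with $$\mu^\alpha_{1/2}\{\xi:\xi_1=\eta_1,\dots,\xi_L=\eta_L\}=\langle w|\prod_{x=1}^{L}\bigl(\eta_xD+(1-\eta_x)E\bigr)|v\rangle\qquad(L\in\mathbb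 N,\ \eta\in\{0,1\}^L),$$ where $D,E$ are non-negative (infinite) matrices and $\langle w|,|v\rangle$ non-negative vectors with $DE=\frac14(D+E)$, $\alpha\langle w|E=\frac14\langle w|$, $(D+E)|v\rangle=|v\rangle$, $\langle w|v\rangle=1$. **The DEHP-tree.** For $\eta\in\{0,1\}^L$ let $\ell(\eta)$ be its number of ones and write $\eta=0^{\tau_0}1^{\sigma_1}0^{\tau_1}\cdots1^{\sigma_A}0^{\tau_A}$, where $A=A(\eta)$ is the number of maximal blocks of ones, $\sigma_j\ge1$ for all $j$, $\tau_j\ge1$ for $0<j<A$, and $\tau_0,\tau_A\ge0$. Put $\Psi_i(\eta)=\sum_{j=i}^A\sigma_j$ $(1\le i\le A+1)$ and $\Phi_i(\eta)=\sum_{j=i}^A\tau_j$ $(0\le i\le A+1)$. The DEHP-tree of $\eta$ has root $(\Psi_1,\Phi_0)$. A node $(x,y)$ with $x=\Psi_i$ and $\Phi_i<y\le\Phi_{i-1}$ for some $1\le i\le A+1$ has one child $(x,y-1)$, joined by an edge of weight $\frac1{4\alpha}$. A node $(x,y)$ with $1\le y\le\Phi_i$ and either $x=\Psi_i$ or $\Psi_{i+1}<x<\Psi_i$,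 for some $1\le i\le A$, has two children $(x,y-1)$ and $(x-1,y)$, each joined by an edge of weight $\frac14$. Nodes $(k,0)$ are endpoints. Let $Z_k(\eta)$ be the sum, over all directed paths from the root to $(k,0)$, of the products of the weights of their edges. **Theorem.** Suppose that $\eta^{\rm step}_t$ converges in law to $\mu^\alpha_{1/2}$ as $t\to\infty$ (this is conjectured). Let $B_n=\{\eta\in\{0,1\}^{M_1+M_2+1}:\ell(\eta)=n\}$. Then $$\lim_{t\to\infty}\mathbb P(f(t)>0)=\sum_{n=0}^{M_1}\ \sum_{\eta\in B_n}\ \sum_{k=0}^{\Psi_1(\eta)}\frac{Z_k(\eta)}{2^k}\Bigl(1+\frac{\alpha-\frac12}{\alpha}\,k\Bigr),$$ and for every integer $0\le m\le M_2$ $$\lim_{t\to\infty}\mathbb P(\mathbf N_2(1,t)=m)=\sum_{\eta\in B_{M_1+M_2+1-m}}\ \sum_{k=0}^{\Psi_1(\eta)}\frac{Z_k(\eta)}{2^k}\Bigl(1+\frac{\alpha-\frac12}{\alpha}\,k\Bigr).$$ -/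

import Mathlib

open Filter Topology MeasureTheory ProbabilityTheory
open scoped NNReal ENNReal

namespace HalfLineTASEP

/-! ### Colours and configurations

The sites of the half-line are the positive integers. Smaller colours have priority; the smallest
colour `⊥` is the first class particle, which is the one injected by the reservoir. -/

/-- The colours `1 < +∞` of the standard (two-colour) process. -/
inductive TwoColor
  | particle
  | hole
  deriving DecidableEq

/-- The colours `1 < 2 < +∞` of the three-colour processes. -/
inductive ThreeColor
  | first
  | second
  | hole
  deriving DecidableEq

namespace TwoColor

/-- Priority of a colour (smaller means stronger). -/
def rank : TwoColor → ℕ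
  | particle => 0
  | hole => 1

instance : LinearOrder TwoColor :=
  LinearOrder.lift' rank (by intro a b; cases a <;> cases b <;> simp [rank])

instance : OrderBot TwoColor where
  bot := particle
  bot_le a := by cases a <;> decide

instance : Fintype TwoColor := ⟨{particle, hole}, by intro a; cases a <;> simp⟩

instance : MeasurableSpace TwoColor := ⊤

end TwoColor

namespace ThreeColor

/-- Priority of a colour (smaller means stronger). -/
def rank : ThreeColor → ℕ
  | first => 0
  | second => 1
  | hole => 2

instance : LinearOrder ThreeColor :=
  LinearOrder.lift' rank (by intro a b; cases a <;> cases b <;> simp [rank])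

instance : OrderBot ThreeColor where
  bot := first
  bot_le a := by cases a <;> decide

instance : Fintype ThreeColor := ⟨{first, second, hole}, by intro a; cases a <;> simp⟩

instance : MeasurableSpace ThreeColor := ⊤

end ThreeColor

/-- A configuration assigns a colour to every site `1, 2, 3, …`. -/
abbrev Config (C : Type*) := ℕ+ → C

/-! ### The dynamics -/

section Dynamics

variable {C : Type*} [LinearOrder C] [OrderBot C]

/-- The reservoir puts a first class particle on site `1`
(this changes the configuration only if the colour at site `1` is larger than `⊥`). -/
def reservoirJump (ζ : Config C) : Config C := Function.update ζ 1 ⊥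

/-- The colours at `x` and `x + 1` are exchanged if the one at `x` is smaller. -/
def bulkJump (x : ℕ+) (ζ : Config C) : Config C :=
  if ζ x < ζ (x + 1) then ζ ∘ Equiv.swap x (x + 1) else ζ

/-- A local function depends on the colours at finitely many sites only. -/
def IsLocal (f : Config C → ℝ) : Prop :=
  ∃ S : Finset ℕ+, ∀ ζ ζ' : Config C, (∀ x ∈ S, ζ x = ζ' x) → f ζ = f ζ'

/-- The generator of the half-line open TASEP: injection at site `1` with rate `α`, and exchange
across every edge `(x, x + 1)` with rate `1`. For local `f` the sum has finitely many nonzero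
terms. -/
noncomputable def generator (α : ℝ) (f : Config C → ℝ) (ζ : Config C) : ℝ :=
  α * (f (reservoirJump ζ) - f ζ) + ∑' x : ℕ+, (f (bulkJump x ζ) - f ζ)

/-- `η` is a half-line open TASEP with reservoir rate `α` started from `ζ₀`: a process with
right-continuous paths with left limits (every site carries a discrete colour) that starts from
`ζ₀` and solves the martingale problem of the generator on local functions. -/
structure IsHalfLineTASEP [Finite C] [MeasurableSpace C] {Ω : Type*} [mΩ : MeasurableSpace Ω]
    (α : ℝ) (ζ₀ : Config C) (P : Measure Ω) (η : ℝ≥0 → Ω → Config C) : Prop where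
  init : ∀ᵐ ω ∂P, η 0 ω = ζ₀
  right_continuous : ∀ ω t x, ∀ᶠ s in 𝓝[>] t, η s ω x = η t ω x
  left_limit : ∀ ω t x, ∃ c, ∀ᶠ s in 𝓝[<] t, η s ω x = c
  martingale : ∃ ℱ : Filtration ℝ≥0 mΩ,
    (∀ t x, Measurable[ℱ t] fun ω => η t ω x) ∧
    ∀ f : Config C → ℝ, IsLocal f →
      Martingale
        (fun (t : ℝ≥0) ω => f (η t ω) - ∫ s in (0 : ℝ)..t, generator α f (η s.toNNReal ω)) ℱ P

end Dynamics

/-! ### Initial configurations and observables -/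

/-- Step initial condition: there is no particle on the half-line. -/
def stepInit : Config TwoColor := fun _ => .hole

/-- `M₁` holes, one second class particle at `M₁ + 1`, first class particles on
`[M₁ + 2, M₁ + M₂ + 1]`, then holes. -/
def shockInit (M₁ M₂ : ℕ) : Config ThreeColor := fun x =>
  if (x : ℕ) = M₁ + 1 then .second
  else if M₁ + 2 ≤ (x : ℕ) ∧ (x : ℕ) ≤ M₁ + M₂ + 1 then .first
  else .hole

/-- `M₁` holes, second class particles on `[M₁ + 1, M₁ + M₂ + 1]`, then holes. -/
def shockInit' (M₁ M₂ : ℕ) : Config ThreeColor := fun x =>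
  if M₁ + 1 ≤ (x : ℕ) ∧ (x : ℕ) ≤ M₁ + M₂ + 1 then .second else .hole

/-- The position of the second class particle, for configurations with at most one of them;
it is `0` if there is none, that is, after it has left the half-line through the reservoir. -/
noncomputable def secondClassPosition (ζ : Config ThreeColor) : ℕ :=
  sInf {n : ℕ | ∃ x : ℕ+, (x : ℕ) = n ∧ ζ x = .second}

/-- The number of particles of colour `c` weakly to the right of `y`. -/
noncomputable def numRight (c : ThreeColor) (y : ℝ) (ζ : Config ThreeColor) : ℕ∞ :=
  {x : ℕ+ | y ≤ (x : ℝ) ∧ ζ x = c}.encard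

/-- Occupation variables of a two-colour configuration: `true` (that is, `1`) for a particle. -/
def occupation (ζ : Config TwoColor) : ℕ+ → Bool := fun x => decide (ζ x = .particle)

/-! ### The matrix product measure -/

/-- Non-negative matrices `D`, `E` and vectors `w`, `v` (possibly infinite) which satisfy the
relations `DE = c(D + E)`, `α⟨w|E = c⟨w|`, `(D + E)|v⟩ = |v⟩`, `⟨w|v⟩ = 1` with `c = 1/4`.
All sums are taken in `[0, ∞]`. -/
structure MatrixAnsatz (α : ℝ) where
  D : ℕ → ℕ → ℝ≥0
  E : ℕ → ℕ → ℝ≥0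
  w : ℕ → ℝ≥0
  v : ℕ → ℝ≥0
  mul_rel : ∀ i j, ∑' k, (D i k * E k j : ℝ≥0∞) = 1 / 4 * (D i j + E i j : ℝ≥0∞)
  left_rel : ∀ j, ENNReal.ofReal α * ∑' i, (w i * E i j : ℝ≥0∞) = 1 / 4 * (w j : ℝ≥0∞)
  right_rel : ∀ i, ∑' j, ((D i j + E i j) * v j : ℝ≥0∞) = (v i : ℝ≥0∞)
  normalized : ∑' i, (w i * v i : ℝ≥0∞) = 1

namespace MatrixAnsatz

variable {α : ℝ} (A : MatrixAnsatz α)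

/-- The matrix of a letter: `D` for `1` and `E` for `0`. -/
def letter (b : Bool) : ℕ → ℕ → ℝ≥0 := if b then A.D else A.E

/-- The vector `∏ₓ (ηₓ D + (1 - ηₓ) E) |v⟩`. -/
noncomputable def applyWord : List Bool → ℕ → ℝ≥0∞
  | [] => fun i => A.v i
  | b :: l => fun i => ∑' j, A.letter b i j * applyWord l j

/-- The number `⟨w| ∏ₓ (ηₓ D + (1 - ηₓ) E) |v⟩`. -/
noncomputable def weight (l : List Bool) : ℝ≥0∞ := ∑' i, A.w i * A.applyWord l i

end MatrixAnsatz

/-- `{ξ : ξ₁ = η₁, …, ξ_L = η_L}` -/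
def wordCylinder {L : ℕ} (η : Fin L → Bool) : Set (ℕ+ → Bool) :=
  {ξ | ∀ i : Fin L, ξ (Nat.succPNat i) = η i}

/-- The probability measure whose cylinder probabilities are given by the matrix product ansatz. -/
def IsMatrixProductMeasure (α : ℝ) (μ : Measure (ℕ+ → Bool)) : Prop :=
  ∃ A : MatrixAnsatz α, ∀ (L : ℕ) (η : Fin L → Bool), μ (wordCylinder η) = A.weight (List.ofFn η)

section Existence

/-- An explicit solution of the relations. -/
noncomputable def explicitD (i j : ℕ) : ℝ≥0 :=
  (if j = i then 1 / 4 else 0) + (if j = i + 1 then 1 / 4 else 0)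

/-- An explicit solution of the relations. -/
noncomputable def explicitE (i j : ℕ) : ℝ≥0 :=
  (if j = i then 1 / 4 else 0) + (if i = j + 1 then 1 / 4 else 0)

theorem tsum_explicitD (i : ℕ) (f : ℕ → ℝ≥0∞) :
    ∑' k, (explicitD i k : ℝ≥0∞) * f k = (1 / 4 : ℝ≥0) * f i + (1 / 4 : ℝ≥0) * f (i + 1) := by
  simp only [explicitD, ENNReal.coe_add, add_mul, ENNReal.tsum_add]
  congr 1
  · rw [tsum_eq_single i]
    · simp
    · intro b hb; simp [hb]
  · rw [tsum_eq_single (i + 1)]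
    · simp
    · intro b hb; simp [hb]

theorem tsum_explicitE_col (j : ℕ) (f : ℕ → ℝ≥0∞) :
    ∑' k, f k * (explicitE k j : ℝ≥0∞) = f j * (1 / 4 : ℝ≥0) + f (j + 1) * (1 / 4 : ℝ≥0) := by
  simp only [explicitE, ENNReal.coe_add, mul_add, ENNReal.tsum_add]
  congr 1
  · rw [tsum_eq_single j]
    · simp
    · intro b hb; simp [Ne.symm hb]
  · rw [tsum_eq_single (j + 1)]
    · simp
    · intro b hb; simp [hb]

theorem tsum_explicitE_zero (f : ℕ → ℝ≥0∞) :
    ∑' k, (explicitE 0 k : ℝ≥0∞) * f k = (1 / 4 : ℝ≥0) * f 0 := by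
  rw [tsum_eq_single 0]
  · simp [explicitE]
  · intro b hb; simp [explicitE, hb]

theorem explicitE_succ (i j : ℕ) : explicitE (i + 1) j = explicitD i j := by
  simp only [explicitE, explicitD]
  rw [add_comm]
  congr 1
  simp [eq_comm]

/-- An explicit solution of the relations for `1/2 < α < 1`. -/
noncomputable def explicitAnsatz (α : ℝ) (h : 1 / 2 < α) (h' : α < 1) : MatrixAnsatz α where
  D := explicitD
  E := explicitE
  w n := ((2 * α - 1) / α).toNNReal ^ 2 * ((1 - α) / α).toNNReal ^ n
  v n := n + 1
  mul_rel i j := by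
    rw [tsum_explicitD i, explicitE_succ, ← mul_add, add_comm]
    congr 1
    simp
  left_rel j := by
    rw [tsum_explicitE_col j (fun k => ((((2 * α - 1) / α).toNNReal ^ 2 *
      ((1 - α) / α).toNNReal ^ k : ℝ≥0) : ℝ≥0∞))]
    have hα : (0 : ℝ) < α := by linarith
    have e : (1 / 4 : ℝ≥0∞) = ((1 / 4 : ℝ≥0) : ℝ≥0∞) := by
      simp
    rw [e, ENNReal.ofReal]
    norm_cast
    apply NNReal.coe_injective
    have h1 : 0 ≤ (2 * α - 1) / α := div_nonneg (by linarith) hα.le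
    have h2 : 0 ≤ (1 - α) / α := div_nonneg (by linarith) hα.le
    push_cast
    rw [Real.coe_toNNReal _ hα.le, Real.coe_toNNReal _ h1, Real.coe_toNNReal _ h2, pow_succ ((1 - α) / α) j]
    generalize ((1 - α) / α) ^ j = q
    generalize ((2 * α - 1) / α) ^ 2 = p
    field_simp
    ring
  right_rel i := by
    simp only [add_mul, ENNReal.tsum_add]
    rw [tsum_explicitD]
    rcases i with _ | i
    · rw [tsum_explicitE_zero]
      norm_cast
      apply NNReal.coe_injective
      push_cast
      norm_num
    · simp only [explicitE_succ]
      rw [tsum_explicitD]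
      norm_cast
      apply NNReal.coe_injective
      push_cast
      ring
  normalized := by
    have hα : (0 : ℝ) < α := by linarith
    have h1 : 0 ≤ (2 * α - 1) / α := div_nonneg (by linarith) hα.le
    have h2 : 0 ≤ (1 - α) / α := div_nonneg (by linarith) hα.le
    have h3 : (1 - α) / α < 1 := by rw [div_lt_one hα]; linarith
    have hn : ‖(1 - α) / α‖ < 1 := by rwa [Real.norm_of_nonneg h2]
    have hs := (hasSum_coe_mul_geometric_of_norm_lt_one hn).add (hasSum_geometric_of_lt_one h2 h3)
    have hs' := hs.mul_left (((2 * α - 1) / α) ^ 2)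
    have hval : ((2 * α - 1) / α) ^ 2 *
        ((1 - α) / α / (1 - (1 - α) / α) ^ 2 + (1 - (1 - α) / α)⁻¹) = 1 := by
      have e : 1 - (1 - α) / α = (2 * α - 1) / α := by field_simp; ring
      have hne : 2 * α - 1 ≠ 0 := by linarith
      rw [e]
      field_simp
      ring
    rw [hval] at hs'
    have key : ∀ i : ℕ, ((((2 * α - 1) / α).toNNReal ^ 2 * ((1 - α) / α).toNNReal ^ i : ℝ≥0) : ℝ≥0∞)
        * (((i : ℝ≥0) + 1 : ℝ≥0) : ℝ≥0∞) = ENNReal.ofReal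
        (((2 * α - 1) / α) ^ 2 * ((i : ℝ) * ((1 - α) / α) ^ i + ((1 - α) / α) ^ i)) := by
      intro i
      rw [ENNReal.ofReal, ← ENNReal.coe_mul]
      congr 1
      apply NNReal.coe_injective
      rw [Real.coe_toNNReal _ (by positivity)]
      push_cast
      rw [Real.coe_toNNReal _ h1, Real.coe_toNNReal _ h2]
      ring
    rw [tsum_congr key, ← ENNReal.ofReal_tsum_of_nonneg (fun i => by positivity) hs'.summable,
      hs'.tsum_eq, ENNReal.ofReal_one]

variable {α : ℝ} (A : MatrixAnsatz α)

theorem sum_applyWord (n : ℕ) (i : ℕ) :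
    ∑ m : Fin n → Bool, A.applyWord (List.ofFn m) i = A.v i := by
  induction n generalizing i with
  | zero => simp [MatrixAnsatz.applyWord]
  | succ n ih =>
    rw [← (Fin.consEquiv fun _ : Fin (n + 1) => Bool).sum_comp, Fintype.sum_prod_type]
    have hcons : ∀ (b : Bool) (m : Fin n → Bool),
        A.applyWord (List.ofFn ((Fin.consEquiv fun _ : Fin (n + 1) => Bool) (b, m))) i
        = ∑' j, (A.letter b i j : ℝ≥0∞) * A.applyWord (List.ofFn m) j := by
      intro b m
      change A.applyWord (List.ofFn (Fin.cons b m : Fin (n + 1) → Bool)) i = _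
      rw [List.ofFn_cons]
      rfl
    simp only [hcons, Fintype.sum_bool]
    have hb : ∀ b : Bool, ∑ m : Fin n → Bool,
        ∑' j, (A.letter b i j : ℝ≥0∞) * A.applyWord (List.ofFn m) j
        = ∑' j, (A.letter b i j : ℝ≥0∞) * A.v j := by
      intro b
      rw [← Summable.tsum_finsetSum (fun _ _ => ENNReal.summable)]
      simp only [← Finset.mul_sum, ih]
    rw [hb, hb, ← ENNReal.tsum_add]
    simp only [MatrixAnsatz.letter, if_true, Bool.false_eq_true, if_false, ← add_mul]
    exact A.right_rel i

theorem sum_applyWord_append (l : List Bool) (n : ℕ) (i : ℕ) :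
    ∑ m : Fin n → Bool, A.applyWord (l ++ List.ofFn m) i = A.applyWord l i := by
  induction l generalizing i with
  | nil => simpa [MatrixAnsatz.applyWord] using sum_applyWord A n i
  | cons b l ih =>
    simp only [List.cons_append, MatrixAnsatz.applyWord]
    rw [← Summable.tsum_finsetSum (fun _ _ => ENNReal.summable)]
    simp only [← Finset.mul_sum, ih]

theorem sum_weight_append (l : List Bool) (n : ℕ) :
    ∑ m : Fin n → Bool, A.weight (l ++ List.ofFn m) = A.weight l := by
  simp only [MatrixAnsatz.weight]
  rw [← Summable.tsum_finsetSum (fun _ _ => ENNReal.summable)]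
  simp only [← Finset.mul_sum, sum_applyWord_append]

theorem weight_nil : A.weight [] = 1 := A.normalized

/-- A finite word, continued by zeros. -/
def extendWord {K : ℕ} (ζ : Fin K → Bool) : ℕ+ → Bool :=
  fun x => if h : x.natPred < K then ζ ⟨x.natPred, h⟩ else false

/-- Discrete approximation with the prescribed law of the first `K` letters. -/
noncomputable def approxMeasure (K : ℕ) : Measure (ℕ+ → Bool) :=
  ∑ ζ : Fin K → Bool, A.weight (List.ofFn ζ) • Measure.dirac (extendWord ζ)

theorem measurableSet_wordCylinder {L : ℕ} (η : Fin L → Bool) :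
    MeasurableSet (wordCylinder η) := by
  have : wordCylinder η = ⋂ i : Fin L, (fun ξ : ℕ+ → Bool => ξ (Nat.succPNat i)) ⁻¹' {η i} := by
    ext ξ; simp [wordCylinder]
  rw [this]
  exact MeasurableSet.iInter fun i => measurable_pi_apply _ (measurableSet_singleton _)

theorem isClopen_wordCylinder {L : ℕ} (η : Fin L → Bool) : IsClopen (wordCylinder η) := by
  have : wordCylinder η = ⋂ i : Fin L, (fun ξ : ℕ+ → Bool => ξ (Nat.succPNat i)) ⁻¹' {η i} := by
    ext ξ; simp [wordCylinder]
  rw [this]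
  exact isClopen_iInter_of_finite fun i => (isClopen_discrete _).preimage (continuous_apply _)

theorem approxMeasure_cylinder {L : ℕ} (η : Fin L → Bool) (n : ℕ) :
    approxMeasure A (L + n) (wordCylinder η) = A.weight (List.ofFn η) := by
  have hmem : ∀ (a : Fin L → Bool) (b : Fin n → Bool),
      extendWord (Fin.append a b) ∈ wordCylinder η ↔ a = η := by
    intro a b
    have hval : ∀ i : Fin L, extendWord (Fin.append a b) (Nat.succPNat i) = a i := by
      intro i
      have hi : (Nat.succPNat (i : ℕ)).natPred < L + n := by
        rw [Nat.natPred_succPNat]; omega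
      rw [extendWord, dif_pos hi]
      exact Fin.append_left a b i
    constructor
    · intro h
      ext1 i
      rw [← hval i]
      exact h i
    · rintro rfl i
      exact hval i
  simp only [approxMeasure, Measure.coe_finsetSum, Finset.sum_apply, Measure.smul_apply,
    smul_eq_mul, Measure.dirac_apply' _ (measurableSet_wordCylinder η)]
  rw [← (Fin.appendEquiv L n).sum_comp, Fintype.sum_prod_type]
  rw [Finset.sum_eq_single η]
  · rw [← sum_weight_append A (List.ofFn η) n]
    refine Finset.sum_congr rfl fun b _ => ?_
    simp only [Fin.appendEquiv, Equiv.coe_fn_mk]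
    rw [Set.indicator_of_mem ((hmem η b).2 rfl), List.ofFn_fin_append]
    simp
  · intro a _ ha
    refine Finset.sum_eq_zero fun b _ => ?_
    simp only [Fin.appendEquiv, Equiv.coe_fn_mk]
    rw [Set.indicator_of_notMem (fun h => ha ((hmem a b).1 h))]
    simp
  · simp

theorem isProbabilityMeasure_approxMeasure (K : ℕ) :
    IsProbabilityMeasure (approxMeasure A K) := by
  constructor
  have h := approxMeasure_cylinder A (L := 0) Fin.elim0 K
  have huniv : wordCylinder (Fin.elim0 : Fin 0 → Bool) = Set.univ := by
    ext ξ; simp [wordCylinder]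
  rw [huniv, zero_add] at h
  simpa [weight_nil] using h

/-- The matrix product measure exists. -/
theorem exists_matrixProductMeasure (α : ℝ) (h : 1 / 2 < α) (h' : α < 1) :
    ∃ μ : ProbabilityMeasure (ℕ+ → Bool),
      IsMatrixProductMeasure α (μ : Measure (ℕ+ → Bool)) := by
  let A := explicitAnsatz α h h'
  let f : ℕ → ProbabilityMeasure (ℕ+ → Bool) := fun K =>
    ⟨approxMeasure A K, isProbabilityMeasure_approxMeasure A K⟩
  let U : Ultrafilter ℕ := Ultrafilter.of atTop
  have hU : (U : Filter ℕ) ≤ atTop := Ultrafilter.of_le _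
  obtain ⟨μ, -, hμ⟩ := (isCompact_univ (X := ProbabilityMeasure (ℕ+ → Bool))).ultrafilter_le_nhds
    (U.map f) (by simp)
  have ht : Tendsto f U (𝓝 μ) := hμ
  refine ⟨μ, A, fun L η => ?_⟩
  have hC := isClopen_wordCylinder η
  have h1 := ProbabilityMeasure.tendsto_measure_of_null_frontier_of_tendsto' ht
    (E := wordCylinder η) (by rw [hC.frontier_eq]; simp)
  have h2 : Tendsto (fun K => (f K : Measure (ℕ+ → Bool)) (wordCylinder η)) U
      (𝓝 (A.weight (List.ofFn η))) := by
    refine Tendsto.congr' ?_ tendsto_const_nhds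
    filter_upwards [hU (eventually_ge_atTop L)] with K hK
    obtain ⟨n, rfl⟩ := Nat.exists_eq_add_of_le hK
    exact (approxMeasure_cylinder A η n).symm
  exact tendsto_nhds_unique h1 h2

end Existence

/-- The measure `μ_{1/2}^α` on `{0, 1}^ℕ`. Its cylinder probabilities are determined by the
relations of the matrix product ansatz, so the choice made here is the only one possible. -/
noncomputable def stationaryMeasure (α : ℝ) (h : 1 / 2 < α) (h' : α < 1) :
    ProbabilityMeasure (ℕ+ → Bool) :=
  (exists_matrixProductMeasure α h h').choose

theorem stationaryMeasure_spec (α : ℝ) (h : 1 / 2 < α) (h' : α < 1) :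
    IsMatrixProductMeasure α (stationaryMeasure α h h' : Measure (ℕ+ → Bool)) :=
  (exists_matrixProductMeasure α h h').choose_spec

/-! ### Clusters of a word and its DEHP-tree -/

/-- Run lengths of a word `0^τ₀ 1^σ₁ 0^τ₁ ⋯ 1^σ_A 0^τ_A` (with `σⱼ ≥ 1` for all `j` and `τⱼ ≥ 1`
for `0 < j < A`), recorded as `(τ₀, [(σ₁, τ₁), …, (σ_A, τ_A)])`. -/
def runs : List Bool → ℕ × List (ℕ × ℕ)
  | [] => (0, [])
  | false :: l => ((runs l).1 + 1, (runs l).2)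
  | true :: l =>
    match runs l with
    | (0, (s, t) :: r) => (0, (s + 1, t) :: r)
    | (t, r) => (0, (1, t) :: r)

section Tree

variable {L : ℕ}

/-- `ℓ(η)`, the number of ones. -/
def numOnes (η : Fin L → Bool) : ℕ := (Finset.univ.filter fun i => η i = true).card

/-- `A(η)`, the number of clusters of ones. -/
def numClusters (η : Fin L → Bool) : ℕ := (runs (List.ofFn η)).2.length

/-- `σⱼ(η)`, the length of the `j`-th cluster of ones, `1 ≤ j ≤ A(η)`. -/
def sigma (η : Fin L → Bool) (j : ℕ) : ℕ := ((runs (List.ofFn η)).2.getD (j - 1) (0, 0)).1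

/-- `τⱼ(η)`: the number of zeros before the first cluster of ones for `j = 0`, and directly after
the `j`-th cluster of ones for `1 ≤ j ≤ A(η)`. -/
def tau (η : Fin L → Bool) (j : ℕ) : ℕ :=
  if j = 0 then (runs (List.ofFn η)).1 else ((runs (List.ofFn η)).2.getD (j - 1) (0, 0)).2

/-- `Ψᵢ(η) = ∑_{j = i}^{A(η)} σⱼ(η)` -/
def Psi (η : Fin L → Bool) (i : ℕ) : ℕ := ∑ j ∈ Finset.Icc i (numClusters η), sigma η j

/-- `Φⱼ(η) = ∑_{k = j}^{A(η)} τₖ(η)` -/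
def Phi (η : Fin L → Bool) (j : ℕ) : ℕ := ∑ k ∈ Finset.Icc j (numClusters η), tau η k

/-- The nodes of the DEHP-tree with one child. -/
def HasOneChild (η : Fin L → Bool) (p : ℕ × ℕ) : Prop :=
  ∃ i, 1 ≤ i ∧ i ≤ numClusters η + 1 ∧ p.1 = Psi η i ∧ Phi η i < p.2 ∧ p.2 ≤ Phi η (i - 1)

/-- The nodes of the DEHP-tree with two children. -/
def HasTwoChildren (η : Fin L → Bool) (p : ℕ × ℕ) : Prop :=
  ∃ i, 1 ≤ i ∧ i ≤ numClusters η ∧ 1 ≤ p.2 ∧ p.2 ≤ Phi η i ∧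
    (p.1 = Psi η i ∨ (Psi η (i + 1) < p.1 ∧ p.1 < Psi η i))

/-- The two kinds of edges of the tree. -/
inductive Direction
  | left
  | right

/-- The left child `(x, y - 1)` and the right child `(x - 1, y)` of the node `(x, y)`. -/
def child (p : ℕ × ℕ) : Direction → ℕ × ℕ
  | .left => (p.1, p.2 - 1)
  | .right => (p.1 - 1, p.2)

/-- The node has a child in the given direction. -/
def HasChild (η : Fin L → Bool) (p : ℕ × ℕ) : Direction → Prop
  | .left => HasOneChild η p ∨ HasTwoChildren η p
  | .right => HasTwoChildren η p

open Classical in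
/-- The weight of the edges from a node to its children: `c` if there are two children, `c / α` if
there is only one, where `c = 1/4`. -/
noncomputable def edgeWeight (α : ℝ) (η : Fin L → Bool) (p : ℕ × ℕ) : ℝ :=
  if HasTwoChildren η p then 1 / 4 else 1 / 4 / α

/-- The sequence of directions describes a directed path starting from the node `p`. -/
def IsPath (η : Fin L → Bool) : ℕ × ℕ → List Direction → Prop
  | _, [] => True
  | p, d :: l => HasChild η p d ∧ IsPath η (child p d) l

/-- The last node of a path starting from `p`. -/
def pathEnd : ℕ × ℕ → List Direction → ℕ × ℕ
  | p, [] => p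
  | p, d :: l => pathEnd (child p d) l

/-- The weight of a path: the product of the weights of its edges. -/
noncomputable def pathWeight (α : ℝ) (η : Fin L → Bool) : ℕ × ℕ → List Direction → ℝ
  | _, [] => 1
  | p, d :: l => edgeWeight α η p * pathWeight α η (child p d) l

/-- The partition function of a node `q`: the sum of the weights of all directed paths from the
root `(Ψ₁(η), Φ₀(η))` to `q`. There are finitely many of them, since `x + y` drops by one along
every edge. -/
noncomputable def nodeZ (α : ℝ) (η : Fin L → Bool) (q : ℕ × ℕ) : ℝ :=
  ∑ᶠ l ∈ {l : List Direction |
      IsPath η (Psi η 1, Phi η 0) l ∧ pathEnd (Psi η 1, Phi η 0) l = q},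
    pathWeight α η (Psi η 1, Phi η 0) l

/-- `Z_k(η)`, the partition function of the endpoint `(k, 0)`. -/
noncomputable def Z (α : ℝ) (η : Fin L → Bool) (k : ℕ) : ℝ := nodeZ α η (k, 0)

/-- `∑_{k = 0}^{Ψ₁(η)} Z_k(η) 2^{-k} (1 + (α - 1/2) k / α)` -/
noncomputable def treeFormula (α : ℝ) (η : Fin L → Bool) : ℝ :=
  ∑ k ∈ Finset.range (Psi η 1 + 1), Z α η k / 2 ^ k * (1 + (α - 1 / 2) / α * k)

end Tree

/-- `B_n`, the set of words of length `L` with `n` ones. -/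
def wordsWithOnes (L n : ℕ) : Finset (Fin L → Bool) :=
  Finset.univ.filter fun η => numOnes η = n

end HalfLineTASEP

open HalfLineTASEP

namespace HalfLineTASEP

/-! The heart of the proof is a duality, a form of colour-position symmetry, between a three-colour
process `ζ` and an independent two-colour process `ξ` with step initial condition. Every jump, in
the bulk or at the reservoir, is an idempotent sorting move. The function `survivors` counts the
second class particles of `ζ` that remain once the particles of `ξ` are inserted, and it does not
change if a move is applied to `ξ` instead of `ζ` (`survivors_bulkJump`, `survivors_reservoirJump`).
Hence the mean of a bounded function of `survivors` at `(ζ_s, ξ_{T-s})` should not depend on `s`. At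
`s = T` nothing is inserted and one sees the second class particles at time `T`. At `s = 0` one sees
the initial block, and `survivors` is a function of the number `N` of particles of `ξ_T` in `[1, M₁
+ M₂ + 1]`: the indicator of `N ≤ M₁` for `shockInit`, and `M₂ + 1 - max 0 (N - M₁)` for
`shockInit'`.

To work with local functions, `survivors` is cut off after finitely many sites. The symmetry then
fails only at the last bond, and the error is controlled by the probability that a non-hole has
travelled that far, at most `t ^ j / j!` (`IsHalfLineTASEP.mean_neIndicator_le`). Removing the
cut-off gives the exact identity `IsHalfLineTASEP.mean_eq_mean_step`.

The assumed convergence in law turns the law of `N` into a sum of matrix products over words. The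
relations `DE = (D + E) / 4` and `⟨w|E = ⟨w| / (4α)` shorten a word until only powers `D ^ k` are
left. The DEHP-tree records this reduction, which is `treeFormula_eq_toReal_weight`. -/

instance : DiscreteMeasurableSpace TwoColor := ⟨fun _ => trivial⟩

instance : DiscreteMeasurableSpace ThreeColor := ⟨fun _ => trivial⟩

/-! ### Local functions of configurations -/

section LocalFunctions

variable {C : Type*}

/-- The function depends on the colours at the sites `1, …, K` only. -/
def DependsUpTo (K : ℕ+) (f : Config C → ℝ) : Prop :=
  ∀ ζ ζ' : Config C, (∀ x ≤ K, ζ x = ζ' x) → f ζ = f ζ'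

theorem DependsUpTo.isLocal {K : ℕ+} {f : Config C → ℝ} (h : DependsUpTo K f) : IsLocal f :=
  ⟨Finset.Icc 1 K, fun ζ ζ' hζ => h ζ ζ' fun x hx => hζ x (by simp [hx])⟩

/-- The configuration with prescribed colours at the sites `1, …, K`, and colour `c` elsewhere. -/
def extendConfig (c : C) {K : ℕ+} (a : Finset.Icc 1 K → C) : Config C :=
  fun x => if h : x ∈ Finset.Icc 1 K then a ⟨x, h⟩ else c

/-- The colours at the sites `1, …, K`. -/
def restrictConfig (K : ℕ+) (ζ : Config C) : Finset.Icc 1 K → C := fun x => ζ x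

theorem extendConfig_restrictConfig (c : C) (K : ℕ+) (ζ : Config C) {x : ℕ+} (hx : x ≤ K) :
    extendConfig c (restrictConfig K ζ) x = ζ x := by
  simp [extendConfig, restrictConfig, hx]

theorem DependsUpTo.apply_extend {K : ℕ+} {f : Config C → ℝ} (h : DependsUpTo K f) (c : C)
    (ζ : Config C) : f (extendConfig c (restrictConfig K ζ)) = f ζ :=
  h _ _ fun _ hx => extendConfig_restrictConfig c K ζ hx

theorem DependsUpTo.exists_bound [Finite C] [Nonempty C] {K : ℕ+} {f : Config C → ℝ}
    (h : DependsUpTo K f) : ∃ B, ∀ ζ, |f ζ| ≤ B := by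
  obtain ⟨c⟩ := ‹Nonempty C›
  obtain ⟨B, hB⟩ := (Set.finite_range
    fun a : Finset.Icc 1 K → C => |f (extendConfig c a)|).bddAbove
  exact ⟨B, fun ζ => hB ⟨restrictConfig K ζ, by simp only [h.apply_extend c ζ]⟩⟩

theorem DependsUpTo.measurable [Finite C] [Nonempty C] [MeasurableSpace C]
    [DiscreteMeasurableSpace C] {K : ℕ+} {f : Config C → ℝ} (h : DependsUpTo K f) :
    Measurable f := by
  obtain ⟨c⟩ := ‹Nonempty C›
  have h1 : f = (fun a : Finset.Icc 1 K → C => f (extendConfig c a)) ∘ restrictConfig K := by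
    ext ζ; exact (h.apply_extend c ζ).symm
  rw [h1]
  exact Measurable.of_discrete.comp (measurable_pi_lambda _ fun x => measurable_pi_apply _)

end LocalFunctions

/-! ### The generator on local functions -/

section Generator

variable {C : Type*} [LinearOrder C]

/-- The max/min form holds whether or not the exchange takes place: a jump sorts two adjacent
colours. -/
theorem bulkJump_apply (x z : ℕ+) (ζ : Config C) :
    bulkJump x ζ z = if z = x then max (ζ x) (ζ (x + 1))
      else if z = x + 1 then min (ζ x) (ζ (x + 1)) else ζ z := by
  have hx : x + 1 ≠ x := (PNat.lt_add_right x 1).ne'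
  unfold bulkJump
  split_ifs with h1 h2 h3 h3 h4
  · subst h2; simp [h1.le]
  · subst h3; simp [h1.le]
  · simp [Equiv.swap_apply_of_ne_of_ne h2 h3]
  · subst h3; simp [not_lt.1 h1]
  · subst h4; simp [not_lt.1 h1]
  · rfl

theorem bulkJump_congr {K : ℕ+} {x : ℕ+} {ζ ζ' : Config C} (hx : x ≤ K)
    (h : ∀ z ≤ K + 1, ζ z = ζ' z) : ∀ z ≤ K + 1, bulkJump x ζ z = bulkJump x ζ' z := by
  intro z hz
  rw [bulkJump_apply, bulkJump_apply, h x (hx.trans (PNat.lt_add_right K 1).le),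
    h (x + 1) (by gcongr), h z hz]

theorem DependsUpTo.bulkJump_of_lt {K x : ℕ+} {f : Config C → ℝ} (h : DependsUpTo K f)
    (hx : K < x) (ζ : Config C) : f (bulkJump x ζ) = f ζ := by
  refine h _ _ fun z hz => ?_
  have h1 : z ≠ x := (hz.trans_lt hx).ne
  have h2 : z ≠ x + 1 := ((hz.trans_lt hx).trans (PNat.lt_add_right x 1)).ne
  rw [bulkJump_apply, if_neg h1, if_neg h2]

variable [OrderBot C]

theorem DependsUpTo.generator_eq {K : ℕ+} {f : Config C → ℝ} (h : DependsUpTo K f) (α : ℝ)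
    (ζ : Config C) : generator α f ζ = α * (f (reservoirJump ζ) - f ζ) +
      ∑ x ∈ Finset.Icc 1 K, (f (bulkJump x ζ) - f ζ) := by
  rw [generator, tsum_eq_sum]
  intro x hx
  rw [h.bulkJump_of_lt (by simpa using hx), sub_self]

/-- The bond `(K, K + 1)` involves one more site, hence `K + 1`. Since the generator preserves
locality, results on means of local functions also apply to the means of their generators. -/
theorem DependsUpTo.generator {K : ℕ+} {f : Config C → ℝ} (h : DependsUpTo K f) (α : ℝ) :
    DependsUpTo (K + 1) (generator α f) := by
  intro ζ ζ' hζ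
  have hK : K ≤ K + 1 := (PNat.lt_add_right K 1).le
  rw [h.generator_eq, h.generator_eq, h ζ ζ' fun x hx => hζ x (hx.trans hK)]
  congr 1
  · congr 2
    refine h _ _ fun x hx => ?_
    by_cases h1 : x = 1
    · subst h1; simp [reservoirJump]
    · simp [reservoirJump, h1, hζ x (hx.trans hK)]
  · refine Finset.sum_congr rfl fun x hx => ?_
    congr 1
    exact h _ _ fun z hz => bulkJump_congr (Finset.mem_Icc.1 hx).2 hζ z (hz.trans hK)

end Generator

/-! ### Time evolution of expectations -/

section MeanBound

variable {C : Type*} {Ω : Type*} [MeasurableSpace Ω]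

/-- The expectation of `f` at time `t`. -/
noncomputable def mean (P : Measure Ω) (η : ℝ≥0 → Ω → Config C) (f : Config C → ℝ) (t : ℝ) : ℝ :=
  ∫ ω, f (η t.toNNReal ω) ∂P

theorem abs_mean_le {P : Measure Ω} [IsProbabilityMeasure P] {η : ℝ≥0 → Ω → Config C}
    {f : Config C → ℝ} {B : ℝ} (hB : ∀ ζ, |f ζ| ≤ B) (t : ℝ) :
    |mean P η f t| ≤ B := by
  have := norm_integral_le_of_norm_le_const (μ := P) (f := fun ω => f (η t.toNNReal ω))
    (ae_of_all _ fun ω => hB (η t.toNNReal ω))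
  simpa [mean] using this

end MeanBound

section Mean

variable {C : Type*} [LinearOrder C] [OrderBot C] [Finite C] [MeasurableSpace C]
  {Ω : Type*} [mΩ : MeasurableSpace Ω] {α : ℝ} {ζ₀ : Config C} {P : Measure Ω}
  {η : ℝ≥0 → Ω → Config C}

theorem IsHalfLineTASEP.measurable (h : IsHalfLineTASEP α ζ₀ P η) (t : ℝ≥0) :
    Measurable (η t) := by
  obtain ⟨ℱ, h1, -⟩ := h.martingale
  exact measurable_pi_lambda _ fun x => (h1 t x).mono (ℱ.le t) le_rfl

variable [DiscreteMeasurableSpace C]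

/-- Joint measurability is what Fubini requires in `IsHalfLineTASEP.mean_eq`. It follows from right
continuity by approximating time from the right on a countable grid. -/
theorem IsHalfLineTASEP.measurable_uncurry (h : IsHalfLineTASEP α ζ₀ P η) {K : ℕ+}
    {f : Config C → ℝ} (hf : DependsUpTo K f) :
    Measurable fun p : ℝ × Ω => f (η p.1.toNNReal p.2) := by
  have hmeas := hf.measurable
  -- `τ n t` is the first multiple of `1 / (n + 1)` strictly after `t`; strictness is needed because
  -- right continuity is stated along `𝓝[>] t`.
  let τ : ℕ → ℝ≥0 → ℝ≥0 := fun n t => ((⌊(n + 1) * t⌋₊ + 1 : ℕ) : ℝ≥0) / (n + 1)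
  have hτ : ∀ t, Tendsto (fun n => τ n t) atTop (𝓝[>] t) := by
    intro t
    have hgt : ∀ n, t < τ n t := by
      intro n
      have h2 : (n + 1 : ℝ≥0) * t < (⌊(n + 1 : ℝ≥0) * t⌋₊ + 1 : ℕ) := by
        push_cast; exact Nat.lt_floor_add_one _
      rw [lt_div_iff₀ (by positivity)]
      rwa [mul_comm]
    have hle : ∀ n, τ n t ≤ t + 1 / ((n : ℝ≥0) + 1) := by
      intro n
      have h3 : (⌊(n + 1 : ℝ≥0) * t⌋₊ : ℝ≥0) ≤ (n + 1) * t := Nat.floor_le (by positivity)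
      rw [div_le_iff₀ (by positivity), add_mul t, one_div_mul_cancel (by positivity), mul_comm t]
      push_cast
      gcongr
    refine tendsto_nhdsWithin_iff.2 ⟨?_, Eventually.of_forall hgt⟩
    refine tendsto_of_tendsto_of_tendsto_of_le_of_le tendsto_const_nhds ?_
      (fun n => (hgt n).le) hle
    simpa using tendsto_const_nhds (x := t).add
      (tendsto_one_div_add_atTop_nhds_zero_nat (𝕜 := ℝ≥0))
  refine measurable_of_tendsto_metrizable
    (f := fun n (p : ℝ × Ω) => f (η (τ n p.1.toNNReal) p.2)) (fun n => ?_) ?_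
  · have h4 : Measurable fun q : ℕ × Ω => f (η (((q.1 + 1 : ℕ) : ℝ≥0) / (n + 1)) q.2) :=
      measurable_from_prod_countable_right fun k =>
        hmeas.comp (h.measurable (((k + 1 : ℕ) : ℝ≥0) / (n + 1)))
    have h5 : Measurable fun p : ℝ × Ω => ((⌊(n + 1 : ℝ≥0) * p.1.toNNReal⌋₊, p.2) : ℕ × Ω) :=
      (Nat.measurable_floor.comp
        (measurable_const.mul (measurable_real_toNNReal.comp measurable_fst))).prodMk measurable_snd
    exact h4.comp h5
  · rw [tendsto_pi_nhds]
    rintro ⟨t, ω⟩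
    refine tendsto_const_nhds.congr' ?_
    have h6 : ∀ᶠ s in 𝓝[>] t.toNNReal, ∀ x ∈ Finset.Icc 1 K, η s ω x = η t.toNNReal ω x :=
      (Finset.eventually_all _).2 fun x _ => h.right_continuous ω _ x
    filter_upwards [(hτ t.toNNReal).eventually h6] with n hn
    exact (hf _ _ fun x hx => hn x (by simp [hx])).symm

variable [IsProbabilityMeasure P]

theorem IsHalfLineTASEP.integrable (h : IsHalfLineTASEP α ζ₀ P η) {K : ℕ+} {f : Config C → ℝ}
    (hf : DependsUpTo K f) (t : ℝ≥0) : Integrable (fun ω => f (η t ω)) P := by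
  obtain ⟨B, hB⟩ := hf.exists_bound
  exact Integrable.of_bound (hf.measurable.comp (h.measurable t)).aestronglyMeasurable B
    (ae_of_all _ fun ω => hB _)

theorem IsHalfLineTASEP.measurable_mean (h : IsHalfLineTASEP α ζ₀ P η) {K : ℕ+}
    {f : Config C → ℝ} (hf : DependsUpTo K f) : Measurable (mean P η f) :=
  ((h.measurable_uncurry hf).stronglyMeasurable.integral_prod_right').measurable

theorem IsHalfLineTASEP.intervalIntegrable_mean (h : IsHalfLineTASEP α ζ₀ P η) {K : ℕ+}
    {f : Config C → ℝ} (hf : DependsUpTo K f) (a b : ℝ) :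
    IntervalIntegrable (mean P η f) volume a b := by
  obtain ⟨B, hB⟩ := hf.exists_bound
  refine (intervalIntegrable_const (c := B)).mono_fun
    (h.measurable_mean hf).aestronglyMeasurable (ae_of_all _ fun t => ?_)
  exact (abs_mean_le hB t).trans (le_abs_self B)

/-- Dynkin's formula: the martingale has the same mean at times `0` and `t`, and Fubini moves the
expectation inside the time integral. -/
theorem IsHalfLineTASEP.mean_eq (h : IsHalfLineTASEP α ζ₀ P η) {K : ℕ+} {f : Config C → ℝ}
    (hf : DependsUpTo K f) {t : ℝ} (ht : 0 ≤ t) :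
    mean P η f t = f ζ₀ + ∫ s in (0 : ℝ)..t, mean P η (generator α f) s := by
  obtain ⟨ℱ, -, hm⟩ := h.martingale
  have hM := hm f hf.isLocal
  have hg := hf.generator α
  obtain ⟨B, hB⟩ := hg.exists_bound
  have huncurry : Integrable (Function.uncurry fun (s : ℝ) ω => generator α f (η s.toNNReal ω))
      ((volume.restrict (Set.uIoc 0 t)).prod P) := by
    have : IsFiniteMeasure (volume.restrict (Set.uIoc 0 t)) := by
      rw [Set.uIoc_of_le ht]; infer_instance
    refine Integrable.of_bound (h.measurable_uncurry hg).aestronglyMeasurable B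
      (ae_of_all _ fun p => hB _)
  have h1 := hM.setIntegral_eq (zero_le (a := t.toNNReal)) MeasurableSet.univ
  simp only [setIntegral_univ, NNReal.coe_zero, intervalIntegral.integral_same, sub_zero,
    Real.coe_toNNReal t ht] at h1
  have h0 : ∫ ω, f (η 0 ω) ∂P = f ζ₀ := by
    rw [integral_congr_ae (g := fun _ => f ζ₀) (h.init.mono fun ω hω => by simp [hω])]
    simp
  have h2 : Integrable (fun ω => ∫ s in (0 : ℝ)..t, generator α f (η s.toNNReal ω)) P := by
    simp only [intervalIntegral.integral_of_le ht]
    rw [Set.uIoc_of_le ht] at huncurry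
    exact huncurry.integral_prod_right
  rw [integral_sub (h.integrable hf _) h2, h0, ← intervalIntegral_integral_swap huncurry] at h1
  simp only [mean]
  linarith

theorem IsHalfLineTASEP.continuous_mean (h : IsHalfLineTASEP α ζ₀ P η) {K : ℕ+}
    {f : Config C → ℝ} (hf : DependsUpTo K f) : Continuous (mean P η f) := by
  -- `Real.toNNReal` freezes the process at time `0` for negative `t`, so Dynkin's formula extends
  -- to the whole line with `max t 0`.
  have h1 : mean P η f = fun t => f ζ₀ + ∫ s in (0 : ℝ)..(max t 0), mean P η (generator α f) s := by
    ext t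
    rw [← h.mean_eq hf (le_max_right t 0)]
    simp only [mean]
    congr! 4
    exact NNReal.eq (by simp)
  rw [h1]
  exact continuous_const.add ((intervalIntegral.continuous_primitive
    (fun a b => h.intervalIntegrable_mean (hf.generator α) a b) 0).comp
      (continuous_id.max continuous_const))

/-- Kolmogorov's forward equation. The integrand in Dynkin's formula is itself the mean of a local
function, hence continuous. -/
theorem IsHalfLineTASEP.hasDerivWithinAt_mean (h : IsHalfLineTASEP α ζ₀ P η) {K : ℕ+}
    {f : Config C → ℝ} (hf : DependsUpTo K f) {T s : ℝ} (hs : s ∈ Set.Icc 0 T) :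
    HasDerivWithinAt (mean P η f) (mean P η (generator α f) s) (Set.Icc 0 T) s := by
  have hg := h.continuous_mean (hf.generator α)
  have h1 : HasDerivAt (fun t => f ζ₀ + ∫ s in (0 : ℝ)..t, mean P η (generator α f) s)
      (mean P η (generator α f) s) s :=
    (intervalIntegral.integral_hasDerivAt_right (hg.intervalIntegrable _ _)
      (hg.stronglyMeasurableAtFilter _ _) hg.continuousAt).const_add _
  exact h1.hasDerivWithinAt.congr (fun t ht => h.mean_eq hf ht.1) (h.mean_eq hf hs.1)

end Mean

/-! ### Finite speed of propagation -/

section Decay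

variable {C : Type*} [LinearOrder C]

/-- The indicator of the event that the colour at `x` is not `c`. -/
def neIndicator (c : C) (x : ℕ+) (ζ : Config C) : ℝ := if ζ x = c then 0 else 1

theorem dependsUpTo_neIndicator (c : C) (x : ℕ+) : DependsUpTo x (neIndicator c x) := by
  intro ζ ζ' h
  simp [neIndicator, h x le_rfl]

theorem neIndicator_nonneg (c : C) (x : ℕ+) (ζ : Config C) : 0 ≤ neIndicator c x ζ := by
  unfold neIndicator; split_ifs <;> norm_num

theorem neIndicator_le_one (c : C) (x : ℕ+) (ζ : Config C) : neIndicator c x ζ ≤ 1 := by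
  unfold neIndicator; split_ifs <;> norm_num

variable [OrderBot C]

/-- Only the bonds on either side of `x + 1` matter. The right one can only weaken the colour at `x
+ 1`, and the left one brings in a non-hole only if there is one at `x`. The reservoir does not
reach `x + 1`. -/
theorem generator_neIndicator_le {c : C} (hc : ∀ a, a ≤ c) (α : ℝ) (x : ℕ+) (ζ : Config C) :
    generator α (neIndicator c (x + 1)) ζ ≤ neIndicator c x ζ := by
  have h0 : neIndicator c (x + 1) (reservoirJump ζ) = neIndicator c (x + 1) ζ := by
    have : x + 1 ≠ 1 := (PNat.lt_add_left 1 x).ne'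
    simp [neIndicator, reservoirJump, this]
  have hne : x + 1 ≠ x := (PNat.lt_add_right x 1).ne'
  have hne' : x + 1 ≠ x + 1 + 1 := (PNat.lt_add_right (x + 1) 1).ne
  rw [(dependsUpTo_neIndicator c (x + 1)).generator_eq, h0, sub_self, mul_zero, zero_add,
    ← Finset.sum_subset (s₁ := {x, x + 1}), Finset.sum_pair hne.symm]
  · have h1 : neIndicator c (x + 1) (bulkJump (x + 1) ζ) - neIndicator c (x + 1) ζ ≤ 0 := by
      simp only [neIndicator, bulkJump_apply, if_true]
      by_cases h : ζ (x + 1) = c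
      · simp [h, hc]
      · simp only [h, if_false]; split_ifs <;> norm_num
    have h2 : neIndicator c (x + 1) (bulkJump x ζ) - neIndicator c (x + 1) ζ
        ≤ neIndicator c x ζ := by
      simp only [neIndicator, bulkJump_apply, if_true, hne, if_false]
      by_cases h : ζ x = c
      · simp [h, hc]
      · simp only [h, if_false]; split_ifs <;> norm_num
    linarith
  · intro z hz
    simp only [Finset.mem_insert, Finset.mem_singleton] at hz
    rcases hz with rfl | rfl
    · simpa using (PNat.lt_add_right z 1).le
    · simp
  · intro z _ hz
    simp only [Finset.mem_insert, Finset.mem_singleton, not_or] at hz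
    have h3 : x + 1 ≠ z := fun h => hz.2 h.symm
    have h4 : x + 1 ≠ z + 1 := fun h => hz.1 (add_right_cancel h).symm
    simp [neIndicator, bulkJump_apply, h3, h4]

variable [Finite C] [MeasurableSpace C] [DiscreteMeasurableSpace C]
  {Ω : Type*} [MeasurableSpace Ω] {α : ℝ} {ζ₀ : Config C} {P : Measure Ω} [IsProbabilityMeasure P]
  {η : ℝ≥0 → Ω → Config C}

/-- Each further site costs one more integration in time of the previous bound, starting from the
trivial bound `1`; the iterated integrals give `t ^ j / j!`. -/
theorem IsHalfLineTASEP.mean_neIndicator_le (h : IsHalfLineTASEP α ζ₀ P η) {c : C}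
    (hc : ∀ a, a ≤ c) {n : ℕ} (h₀ : ∀ i, n < i → ζ₀ (Nat.succPNat i) = c) (j : ℕ) {t : ℝ}
    (ht : 0 ≤ t) : mean P η (neIndicator c (Nat.succPNat (n + j))) t ≤ t ^ j / j.factorial := by
  induction j generalizing t with
  | zero =>
    have := (abs_le.1 (abs_mean_le (P := P) (η := η) (f := neIndicator c (Nat.succPNat n)) (B := 1)
      (fun ζ => abs_le.2 ⟨by linarith [neIndicator_nonneg c (Nat.succPNat n) ζ],
        neIndicator_le_one _ _ _⟩) t)).2
    simpa using this
  | succ j ih =>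
    have hdep := dependsUpTo_neIndicator c (Nat.succPNat (n + j))
    have hdep' := dependsUpTo_neIndicator c (Nat.succPNat (n + j) + 1)
    have h1 : neIndicator c (Nat.succPNat (n + j) + 1) ζ₀ = 0 := by
      have h2 : ζ₀ (Nat.succPNat (n + j) + 1) = c := h₀ (n + (j + 1)) (by omega)
      simp [neIndicator, h2]
    change mean P η (neIndicator c (Nat.succPNat (n + j) + 1)) t ≤ _
    rw [h.mean_eq hdep' ht, h1, zero_add]
    calc ∫ s in (0 : ℝ)..t, mean P η (generator α (neIndicator c (Nat.succPNat (n + j) + 1))) s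
        ≤ ∫ s in (0 : ℝ)..t, s ^ j / (j.factorial : ℝ) := by
          refine intervalIntegral.integral_mono_on ht
            (h.intervalIntegrable_mean (hdep'.generator α) _ _)
            (by apply Continuous.intervalIntegrable; fun_prop) fun s hs => ?_
          refine le_trans ?_ (ih hs.1)
          exact integral_mono (h.integrable (hdep'.generator α) _) (h.integrable hdep _)
            fun ω => generator_neIndicator_le hc α _ _
      _ = t ^ (j + 1) / ((j + 1).factorial : ℝ) := by
          rw [intervalIntegral.integral_div, integral_pow, Nat.factorial_succ]
          push_cast
          field_simp
          simp

end Decay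

/-! ### Approximate duality from approximate intertwining of generators -/

section Duality

variable {C : Type*} [LinearOrder C] [OrderBot C]

theorem generator_sum {ι : Type*} (s : Finset ι) {K : ℕ+} {f : ι → Config C → ℝ}
    (hf : ∀ i, DependsUpTo K (f i)) (c : ι → ℝ) (α : ℝ) (ζ : Config C) :
    generator α (fun ζ => ∑ i ∈ s, c i * f i ζ) ζ = ∑ i ∈ s, c i * generator α (f i) ζ := by
  have h : DependsUpTo K (fun ζ => ∑ i ∈ s, c i * f i ζ) := fun ζ ζ' hζ =>
    Finset.sum_congr rfl fun i _ => by rw [hf i ζ ζ' hζ]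
  simp only [h.generator_eq, fun i => (hf i).generator_eq, ← Finset.sum_sub_distrib, ← mul_sub]
  rw [Finset.sum_comm, Finset.mul_sum, ← Finset.sum_add_distrib]
  refine Finset.sum_congr rfl fun i _ => ?_
  rw [← Finset.mul_sum]
  ring

open Classical in
/-- The indicator of the event that the colours at the sites `1, …, K` are given by `a`. -/
noncomputable def cylinderIndicator {C : Type*} {K : ℕ+} (a : Finset.Icc 1 K → C)
    (ζ : Config C) : ℝ := if restrictConfig K ζ = a then 1 else 0

theorem dependsUpTo_cylinderIndicator {C : Type*} {K : ℕ+} (a : Finset.Icc 1 K → C) :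
    DependsUpTo K (cylinderIndicator a) := by
  intro ζ ζ' h
  have : restrictConfig K ζ = restrictConfig K ζ' := by
    ext ⟨x, hx⟩; exact h x (Finset.mem_Icc.1 hx).2
  classical
  exact congrArg (fun r => if r = a then (1 : ℝ) else 0) this

theorem sum_mul_cylinderIndicator {C : Type*} {K : ℕ+} [Fintype (Finset.Icc 1 K → C)]
    (g : (Finset.Icc 1 K → C) → ℝ) (ζ : Config C) :
    ∑ a, g a * cylinderIndicator a ζ = g (restrictConfig K ζ) := by
  classical
  simp [cylinderIndicator]

variable [Finite C] [MeasurableSpace C] [DiscreteMeasurableSpace C]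
  {C' : Type*} [LinearOrder C'] [OrderBot C'] [Finite C'] [MeasurableSpace C']
  [DiscreteMeasurableSpace C']
  {Ω Ω' : Type*} [MeasurableSpace Ω] [MeasurableSpace Ω'] {α : ℝ}
  {ζ₀ : Config C} {P : Measure Ω} [IsProbabilityMeasure P] {η : ℝ≥0 → Ω → Config C}
  {ξ₀ : Config C'} {P' : Measure Ω'} [IsProbabilityMeasure P'] {ξ : ℝ≥0 → Ω' → Config C'}

theorem IsHalfLineTASEP.mean_zero (h : IsHalfLineTASEP α ζ₀ P η) {K : ℕ+} {f : Config C → ℝ}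
    (hf : DependsUpTo K f) : mean P η f 0 = f ζ₀ := by
  rw [h.mean_eq hf le_rfl, intervalIntegral.integral_same, add_zero]

/-- Two processes whose generators have the same action on a function of both configurations, up to
a small error, are dual to each other, up to a small error. -/
theorem abs_mean_sub_mean_le_of_generator (h : IsHalfLineTASEP α ζ₀ P η)
    (h' : IsHalfLineTASEP α ξ₀ P' ξ) {K : ℕ+} {H : Config C → Config C' → ℝ}
    (hH : ∀ y, DependsUpTo K fun x => H x y) (hH' : ∀ x, DependsUpTo K (H x))
    {a : Config C → ℝ} {b : Config C' → ℝ} (ha : DependsUpTo K a) (hb : DependsUpTo K b)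
    (hgen : ∀ x y, |generator α (fun x => H x y) x - generator α (H x) y| ≤ a x + b y)
    {T ε : ℝ} (hT : 0 ≤ T) (haε : ∀ t ∈ Set.Icc 0 T, mean P η a t ≤ ε)
    (hbε : ∀ t ∈ Set.Icc 0 T, mean P' ξ b t ≤ ε) :
    |mean P η (fun x => H x ξ₀) T - mean P' ξ (H ζ₀) T| ≤ 2 * ε * T := by
  classical
  have := Fintype.ofFinite C'
  let e : (Finset.Icc 1 K → C') → Config C' := extendConfig ⊥
  have hHe : ∀ y, (fun x => H x (e (restrictConfig K y))) = fun x => H x y := fun y => by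
    ext x; exact (hH' x).apply_extend ⊥ y
  have hHsum : ∀ x, H x = fun y => ∑ c, H x (e c) * cylinderIndicator c y := fun x => by
    ext y; rw [sum_mul_cylinderIndicator (fun c => H x (e c))]; exact (congrFun (hHe y) x).symm
  have hcyl := fun c : Finset.Icc 1 K → C' => dependsUpTo_cylinderIndicator c
  -- `ψ s` is the mean of `H` at the independent pair `(η_s, ξ_{T-s})`. Expanding in cylinder
  -- indicators of the second argument makes it a finite sum of products of one-process means, so it
  -- can be differentiated term by term.
  let ψ : ℝ → ℝ := fun s =>
    ∑ c, mean P η (fun x => H x (e c)) s * mean P' ξ (cylinderIndicator c) (T - s)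
  let ψ' : ℝ → ℝ := fun s => ∑ c,
    (mean P η (generator α fun x => H x (e c)) s * mean P' ξ (cylinderIndicator c) (T - s) -
      mean P η (fun x => H x (e c)) s * mean P' ξ (generator α (cylinderIndicator c)) (T - s))
  have hψ : ∀ s ∈ Set.Icc 0 T, HasDerivWithinAt ψ (ψ' s) (Set.Icc 0 T) s := by
    intro s hs
    refine HasDerivWithinAt.fun_sum fun c _ => ?_
    have h1 := h.hasDerivWithinAt_mean (hH (e c)) hs
    have hs' : T - s ∈ Set.Icc 0 T := ⟨by linarith [hs.2], by linarith [hs.1]⟩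
    have h2 := h'.hasDerivWithinAt_mean (hcyl c) hs'
    have h3 : HasDerivWithinAt (fun s => T - s) (-1) (Set.Icc 0 T) s :=
      ((hasDerivAt_id s).const_sub T).hasDerivWithinAt
    have h4 := HasDerivWithinAt.comp s h2 h3 fun r hr => ⟨by linarith [hr.2], by linarith [hr.1]⟩
    exact (h1.mul h4).congr_deriv (by simp only [Function.comp_apply]; ring)
  have hψT : ψ T = mean P η (fun x => H x ξ₀) T := by
    simp only [ψ, sub_self, fun c => h'.mean_zero (hcyl c)]
    rw [sum_mul_cylinderIndicator (fun c => mean P η (fun x => H x (e c)) T), hHe]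
  have hψ0 : ψ 0 = mean P' ξ (H ζ₀) T := by
    simp only [ψ, sub_zero, fun c => h.mean_zero (hH (e c))]
    have h5 : mean P' ξ (H ζ₀) T = mean P' ξ (fun y => ∑ c, H ζ₀ (e c) * cylinderIndicator c y) T :=
      congrArg (fun g => mean P' ξ g T) (hHsum ζ₀)
    rw [h5]
    simp only [mean]
    rw [integral_finsetSum _ fun c _ => (h'.integrable (hcyl c) _).const_mul _]
    simp only [integral_const_mul]
  have hbound : ∀ s ∈ Set.Ico 0 T, ‖ψ' s‖ ≤ 2 * ε := by
    intro s hs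
    have hs' : T - s ∈ Set.Icc 0 T := ⟨by linarith [hs.2], by linarith [hs.1]⟩
    let X := η s.toNNReal
    let Y := ξ (T - s).toNNReal
    have hint1 : ∀ c, Integrable (fun z : Ω × Ω' =>
        generator α (fun x => H x (e c)) (X z.1) * cylinderIndicator c (Y z.2)) (P.prod P') :=
      fun c => Integrable.mul_prod (f := fun ω => generator α (fun x => H x (e c)) (X ω))
        (g := fun ω => cylinderIndicator c (Y ω))
        (h.integrable ((hH (e c)).generator α) s.toNNReal)
        (h'.integrable (hcyl c) (T - s).toNNReal)
    have hint2 : ∀ c, Integrable (fun z : Ω × Ω' =>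
        H (X z.1) (e c) * generator α (cylinderIndicator c) (Y z.2)) (P.prod P') :=
      fun c => Integrable.mul_prod (f := fun ω => H (X ω) (e c))
        (g := fun ω => generator α (cylinderIndicator c) (Y ω))
        (h.integrable (hH (e c)) s.toNNReal)
        (h'.integrable ((hcyl c).generator α) (T - s).toNNReal)
    -- The derivative is reassembled into one expectation under the product measure, where the
    -- pointwise bound `hgen` applies.
    have hψint : ψ' s = ∫ z, (generator α (fun x => H x (Y z.2)) (X z.1) -
        generator α (H (X z.1)) (Y z.2)) ∂P.prod P' := by
      simp only [ψ', mean]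
      have h5 : ∀ z : Ω × Ω', generator α (fun x => H x (Y z.2)) (X z.1) -
          generator α (H (X z.1)) (Y z.2) = ∑ c,
          (generator α (fun x => H x (e c)) (X z.1) * cylinderIndicator c (Y z.2) -
            H (X z.1) (e c) * generator α (cylinderIndicator c) (Y z.2)) := by
        intro z
        rw [Finset.sum_sub_distrib,
          sum_mul_cylinderIndicator (fun c => generator α (fun x => H x (e c)) (X z.1)), hHe,
          ← generator_sum _ hcyl, ← hHsum]
      simp only [h5]
      refine ((integral_finsetSum _ fun c _ => (hint1 c).sub (hint2 c)).trans ?_).symm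
      simp only [Pi.sub_apply]
      refine Finset.sum_congr rfl fun c _ => ?_
      rw [integral_sub (hint1 c) (hint2 c),
        integral_prod_mul (fun ω => generator α (fun x => H x (e c)) (X ω))
          (fun ω => cylinderIndicator c (Y ω)),
        integral_prod_mul (fun ω => H (X ω) (e c))
          (fun ω => generator α (cylinderIndicator c) (Y ω))]
    have hia := (h.integrable ha s.toNNReal).comp_fst P'
    have hib := (h'.integrable hb (T - s).toNNReal).comp_snd P
    rw [hψint]
    refine (norm_integral_le_of_norm_le (hia.add hib) (ae_of_all _ fun z => hgen _ _)).trans ?_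
    simp only [Pi.add_apply]
    rw [integral_add hia hib, integral_fun_fst (fun ω => a (η s.toNNReal ω)),
      integral_fun_snd (fun ω => b (ξ (T - s).toNNReal ω))]
    have h6 := haε s ⟨hs.1, hs.2.le⟩
    have h7 := hbε _ hs'
    simp only [mean] at h6 h7
    simp
    linarith
  have := norm_image_sub_le_of_norm_deriv_le_segment' hψ hbound T ⟨hT, le_rfl⟩
  rwa [hψT, hψ0, sub_zero] at this

end Duality

/-! ### Maximal partial sums -/

section MaxPartialSum

/-- The maximum of the partial sums `∑_{i < y} d i` over `0 ≤ y ≤ K`. -/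
def maxPartialSum : (ℕ → ℤ) → ℕ → ℤ
  | _, 0 => 0
  | d, K + 1 => max 0 (d 0 + maxPartialSum (fun i => d (i + 1)) K)

theorem maxPartialSum_nonneg (d : ℕ → ℤ) (K : ℕ) : 0 ≤ maxPartialSum d K := by
  cases K <;> simp [maxPartialSum]

theorem maxPartialSum_congr {d d' : ℕ → ℤ} {K : ℕ} (h : ∀ i < K, d i = d' i) :
    maxPartialSum d K = maxPartialSum d' K := by
  induction K generalizing d d' with
  | zero => rfl
  | succ K ih =>
    simp only [maxPartialSum]
    rw [h 0 (by omega), ih fun i hi => h (i + 1) (by omega)]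

theorem sum_le_maxPartialSum (d : ℕ → ℤ) {K y : ℕ} (hy : y ≤ K) :
    ∑ i ∈ Finset.range y, d i ≤ maxPartialSum d K := by
  induction K generalizing d y with
  | zero => simp [Nat.le_zero.1 hy, maxPartialSum]
  | succ K ih =>
    rcases y with _ | y
    · simpa using maxPartialSum_nonneg d (K + 1)
    · rw [Finset.sum_range_succ', maxPartialSum]
      have := ih (fun i => d (i + 1)) (Nat.le_of_succ_le_succ hy)
      omega

theorem exists_maxPartialSum_eq (d : ℕ → ℤ) (K : ℕ) :
    ∃ y ≤ K, maxPartialSum d K = ∑ i ∈ Finset.range y, d i := by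
  induction K generalizing d with
  | zero => exact ⟨0, le_rfl, rfl⟩
  | succ K ih =>
    obtain ⟨y, hy, h⟩ := ih fun i => d (i + 1)
    rcases le_total 0 (d 0 + maxPartialSum (fun i => d (i + 1)) K) with h0 | h0
    · refine ⟨y + 1, by omega, ?_⟩
      rw [Finset.sum_range_succ', maxPartialSum, max_eq_right h0, h, add_comm]
    · exact ⟨0, by omega, by simp [maxPartialSum, h0]⟩

/-- Two adjacent increments enter only through their total and through the largest of the three
partial sums within the pair. The bulk symmetry is thereby reduced to a check on two sites. -/
theorem maxPartialSum_eq_of_adjacent {d d' : ℕ → ℤ} {i K : ℕ} (hi : i + 1 < K)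
    (hd : ∀ j, j ≠ i → j ≠ i + 1 → d j = d' j) (hsum : d i + d (i + 1) = d' i + d' (i + 1))
    (hmax : max (max 0 (d i)) (d i + d (i + 1)) = max (max 0 (d' i)) (d' i + d' (i + 1))) :
    maxPartialSum d K = maxPartialSum d' K := by
  induction i generalizing d d' K with
  | zero =>
    obtain ⟨K, rfl⟩ : ∃ k, K = k + 2 := ⟨K - 2, by omega⟩
    simp only [maxPartialSum]
    rw [maxPartialSum_congr (d := fun i => d (i + 1 + 1)) (d' := fun i => d' (i + 1 + 1))
      fun j _ => hd _ (by omega) (by omega)]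
    have := maxPartialSum_nonneg (fun i => d' (i + 1 + 1)) K
    omega
  | succ i ih =>
    obtain ⟨K, rfl⟩ : ∃ k, K = k + 1 := ⟨K - 1, by omega⟩
    simp only [maxPartialSum]
    rw [hd 0 (by omega) (by omega), ih (d := fun i => d (i + 1)) (d' := fun i => d' (i + 1))
      (by omega) (fun j h1 h2 => hd _ (by omega) (by omega)) hsum hmax]

theorem sum_range_eq_of_adjacent {d d' : ℕ → ℤ} {i K : ℕ} (hi : i + 1 < K)
    (hd : ∀ j, j ≠ i → j ≠ i + 1 → d j = d' j) (hsum : d i + d (i + 1) = d' i + d' (i + 1)) :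
    ∑ j ∈ Finset.range K, d j = ∑ j ∈ Finset.range K, d' j := by
  have h : ∀ f : ℕ → ℤ, ∑ j ∈ Finset.range K, f j =
      ∑ j ∈ (Finset.range K \ {i, i + 1}), f j + (f i + f (i + 1)) := by
    intro f
    rw [← Finset.sum_sdiff (s₁ := {i, i + 1}), Finset.sum_pair (by omega)]
    intro j hj
    simp only [Finset.mem_insert, Finset.mem_singleton] at hj
    simp only [Finset.mem_range]
    omega
  rw [h, h, hsum]
  congr 1
  refine Finset.sum_congr rfl fun j hj => ?_
  simp only [Finset.mem_sdiff, Finset.mem_insert, Finset.mem_singleton, not_or] at hj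
  exact hd j hj.2.1 hj.2.2

/-- Particles are matched with sites weakly to their left; all of the sites `0, …, a - 1` and
`L, L + 1, …` are available, and those in between are not. -/
theorem maxPartialSum_sub {p q : ℕ → ℤ} {a L K : ℕ} (haL : a ≤ L) (hLK : L ≤ K)
    (hp : ∀ i, 0 ≤ p i) (hp' : ∀ i, p i ≤ 1) (hq : ∀ i < a, q i = 1)
    (hq' : ∀ i, a ≤ i → i < L → q i = 0) (hq'' : ∀ i, L ≤ i → q i = 1) :
    maxPartialSum (fun i => p i - q i) K = max 0 (∑ i ∈ Finset.range L, p i - a) := by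
  -- The partial sums weakly decrease up to `a`, weakly increase from `a` to `L`, and weakly
  -- decrease afterwards, so only `y = 0` and `y = L` compete for the maximum.
  have h1 : ∀ y ≤ a, ∑ i ∈ Finset.range y, (p i - q i) = ∑ i ∈ Finset.range y, p i - y := by
    intro y hy
    rw [Finset.sum_sub_distrib, Finset.sum_congr rfl fun i hi =>
      hq i ((Finset.mem_range.1 hi).trans_le hy)]
    simp
  have h2 : ∀ y, a ≤ y → y ≤ L →
      ∑ i ∈ Finset.range y, (p i - q i) = ∑ i ∈ Finset.range y, p i - a := by
    intro y hy
    induction y, hy using Nat.le_induction with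
    | base => intro _; exact h1 a le_rfl
    | succ y hy ih =>
      intro hyL
      rw [Finset.sum_range_succ, Finset.sum_range_succ, ih (by omega), hq' y hy (by omega)]
      ring
  have h3 : ∀ y, L ≤ y →
      ∑ i ∈ Finset.range y, (p i - q i) ≤ ∑ i ∈ Finset.range L, p i - a := by
    intro y hy
    induction y, hy using Nat.le_induction with
    | base => exact (h2 L haL le_rfl).le
    | succ y hy ih =>
      rw [Finset.sum_range_succ, hq'' y hy]
      linarith [hp' y]
  apply le_antisymm
  · obtain ⟨y, -, hy⟩ := exists_maxPartialSum_eq (fun i => p i - q i) K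
    rw [hy]
    rcases le_total y a with hya | hya
    · rw [h1 y hya]
      have : ∑ i ∈ Finset.range y, p i ≤ ∑ i ∈ Finset.range y, 1 :=
        Finset.sum_le_sum fun i _ => hp' i
      simp only [Finset.sum_const, Finset.card_range, nsmul_eq_mul, mul_one] at this
      exact le_max_of_le_left (by linarith)
    rcases le_total y L with hyL | hyL
    · rw [h2 y hya hyL]
      have : ∑ i ∈ Finset.range y, p i ≤ ∑ i ∈ Finset.range L, p i :=
        Finset.sum_le_sum_of_subset_of_nonneg (by simpa using hyL) fun i _ _ => hp i
      exact le_max_of_le_right (by linarith)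
    · exact le_max_of_le_right (h3 y hyL)
  · refine max_le (maxPartialSum_nonneg _ _) ?_
    rw [← h2 L haL le_rfl]
    exact sum_le_maxPartialSum _ hLK

end MaxPartialSum

/-! ### The duality function and its symmetry -/

section DualityFunction

/-- The indicator of a particle. -/
def TwoColor.isParticle : TwoColor → ℤ
  | .particle => 1
  | .hole => 0

/-- The indicator of a hole. -/
def ThreeColor.isHole : ThreeColor → ℤ
  | .first => 0
  | .second => 0
  | .hole => 1

/-- The indicator of a colour which is not first class. -/
def ThreeColor.notFirst : ThreeColor → ℤ
  | .first => 0
  | .second => 1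
  | .hole => 1

/-- The indicator of a second class particle. -/
def ThreeColor.isSecond : ThreeColor → ℤ
  | .first => 0
  | .second => 1
  | .hole => 0

/-- The number of second class particles of `ζ` in `1, …, K` that are left after the particles of
`ξ` were inserted: every particle removes the weakest colour weakly to its left. -/
def survivors (K : ℕ) (ζ : Config ThreeColor) (ξ : Config TwoColor) : ℤ :=
  -- By Hall's theorem, the maximal excess of particles over available sites in an initial segment
  -- is the number of particles that cannot be matched to an available site weakly to their left.
  -- The particles that find no hole but do find a colour other than `first` are those that remove a
  -- second class particle, so their number is the difference of the two deficiencies.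
  ∑ i ∈ Finset.range K, (ζ (Nat.succPNat i)).isSecond
    - maxPartialSum (fun i => (ξ (Nat.succPNat i)).isParticle - (ζ (Nat.succPNat i)).isHole) K
    + maxPartialSum (fun i => (ξ (Nat.succPNat i)).isParticle - (ζ (Nat.succPNat i)).notFirst) K

theorem survivors_congr {K : ℕ} {ζ ζ' : Config ThreeColor} {ξ ξ' : Config TwoColor}
    (h : ∀ x ≤ Nat.succPNat K, ζ x = ζ' x) (h' : ∀ x ≤ Nat.succPNat K, ξ x = ξ' x) :
    survivors (K + 1) ζ ξ = survivors (K + 1) ζ' ξ' := by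
  have hle : ∀ i < K + 1, Nat.succPNat i ≤ Nat.succPNat K := fun i hi => by
    rw [Nat.succPNat_le_succPNat]; omega
  unfold survivors
  congr 1
  · congr 1
    · exact Finset.sum_congr rfl fun i hi => by rw [h _ (hle i (Finset.mem_range.1 hi))]
    · exact maxPartialSum_congr fun i hi => by rw [h _ (hle i hi), h' _ (hle i hi)]
  · exact maxPartialSum_congr fun i hi => by rw [h _ (hle i hi), h' _ (hle i hi)]

theorem bulkJump_adjacent {C : Type*} [LinearOrder C] (i : ℕ) (ζ : Config C) :
    bulkJump (Nat.succPNat i) ζ (Nat.succPNat i) =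
        max (ζ (Nat.succPNat i)) (ζ (Nat.succPNat (i + 1))) ∧
      bulkJump (Nat.succPNat i) ζ (Nat.succPNat (i + 1)) =
        min (ζ (Nat.succPNat i)) (ζ (Nat.succPNat (i + 1))) ∧
      ∀ j, j ≠ i → j ≠ i + 1 → bulkJump (Nat.succPNat i) ζ (Nat.succPNat j) =
        ζ (Nat.succPNat j) := by
  have h1 : Nat.succPNat i + 1 = Nat.succPNat (i + 1) := rfl
  have h2 : ∀ j k, Nat.succPNat j = Nat.succPNat k ↔ j = k := fun j k =>
    Nat.succPNat_injective.eq_iff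
  refine ⟨?_, ?_, fun j hj hj' => ?_⟩
  · simp [bulkJump_apply, h1]
  · simp [bulkJump_apply, h1, h2]
  · simp [bulkJump_apply, h1, h2, hj, hj']

/-- These two equalities are the hypotheses of `maxPartialSum_eq_of_adjacent` at the exchanged bond;
there are 36 colour patterns to check. -/
theorem exchange_isHole (a b : ThreeColor) (p q : TwoColor) :
    (p.isParticle - (max a b).isHole) + (q.isParticle - (min a b).isHole) =
        ((max p q).isParticle - a.isHole) + ((min p q).isParticle - b.isHole) ∧
      max (max 0 (p.isParticle - (max a b).isHole))
        ((p.isParticle - (max a b).isHole) + (q.isParticle - (min a b).isHole)) =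
      max (max 0 ((max p q).isParticle - a.isHole))
        (((max p q).isParticle - a.isHole) + ((min p q).isParticle - b.isHole)) := by
  cases a <;> cases b <;> cases p <;> cases q <;> decide

theorem exchange_notFirst (a b : ThreeColor) (p q : TwoColor) :
    (p.isParticle - (max a b).notFirst) + (q.isParticle - (min a b).notFirst) =
        ((max p q).isParticle - a.notFirst) + ((min p q).isParticle - b.notFirst) ∧
      max (max 0 (p.isParticle - (max a b).notFirst))
        ((p.isParticle - (max a b).notFirst) + (q.isParticle - (min a b).notFirst)) =
      max (max 0 ((max p q).isParticle - a.notFirst))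
        (((max p q).isParticle - a.notFirst) + ((min p q).isParticle - b.notFirst)) := by
  cases a <;> cases b <;> cases p <;> cases q <;> decide

theorem exchange_isSecond (a b : ThreeColor) :
    (max a b).isSecond + (min a b).isSecond = a.isSecond + b.isSecond := by
  cases a <;> cases b <;> decide

theorem survivors_bulkJump {i K : ℕ} (hi : i + 1 < K) (ζ : Config ThreeColor)
    (ξ : Config TwoColor) :
    survivors K (bulkJump (Nat.succPNat i) ζ) ξ = survivors K ζ (bulkJump (Nat.succPNat i) ξ) := by
  obtain ⟨hζ, hζ', hζ''⟩ := bulkJump_adjacent i ζ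
  obtain ⟨hξ, hξ', hξ''⟩ := bulkJump_adjacent i ξ
  unfold survivors
  congr 1
  · congr 1
    · refine sum_range_eq_of_adjacent hi (fun j h1 h2 => by rw [hζ'' j h1 h2]) ?_
      rw [hζ, hζ', exchange_isSecond]
    · refine maxPartialSum_eq_of_adjacent hi (fun j h1 h2 => by rw [hζ'' j h1 h2, hξ'' j h1 h2])
        ?_ ?_
      · rw [hζ, hζ', hξ, hξ']; exact (exchange_isHole _ _ _ _).1
      · rw [hζ, hζ', hξ, hξ']; exact (exchange_isHole _ _ _ _).2
  · refine maxPartialSum_eq_of_adjacent hi (fun j h1 h2 => by rw [hζ'' j h1 h2, hξ'' j h1 h2])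
      ?_ ?_
    · rw [hζ, hζ', hξ, hξ']; exact (exchange_notFirst _ _ _ _).1
    · rw [hζ, hζ', hξ, hξ']; exact (exchange_notFirst _ _ _ _).2

/-- A particle of `ξ` at site `1` has only the colour at site `1` of `ζ` available to remove, which
is also what injection into `ζ` does. If there is nothing to remove, both deficiencies rise by one
and cancel. -/
theorem survivors_reservoirJump (K : ℕ) (ζ : Config ThreeColor) (ξ : Config TwoColor) :
    survivors (K + 1) (reservoirJump ζ) ξ = survivors (K + 1) ζ (reservoirJump ξ) := by
  have h0 : Nat.succPNat 0 = 1 := rfl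
  have h1 : ∀ i, Nat.succPNat (i + 1) ≠ 1 := fun i h =>
    Nat.succ_ne_zero i (Nat.succPNat_injective (h.trans h0.symm))
  have hb : (⊥ : ThreeColor) = .first := rfl
  have hb' : (⊥ : TwoColor) = .particle := rfl
  simp only [survivors, maxPartialSum, Finset.sum_range_succ', h0, reservoirJump,
    Function.update_self, ne_eq, h1, not_false_eq_true, Function.update_of_ne, hb, hb']
  have hm := maxPartialSum_nonneg (fun i => (ξ (Nat.succPNat (i + 1))).isParticle -
    (ζ (Nat.succPNat (i + 1))).isHole) K
  have hm' := maxPartialSum_nonneg (fun i => (ξ (Nat.succPNat (i + 1))).isParticle -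
    (ζ (Nat.succPNat (i + 1))).notFirst) K
  generalize maxPartialSum (fun i => (ξ (Nat.succPNat (i + 1))).isParticle -
    (ζ (Nat.succPNat (i + 1))).isHole) K = m at *
  generalize maxPartialSum (fun i => (ξ (Nat.succPNat (i + 1))).isParticle -
    (ζ (Nat.succPNat (i + 1))).notFirst) K = m' at *
  cases ζ 1 <;> cases ξ 1 <;>
    simp only [ThreeColor.isSecond, ThreeColor.isHole, ThreeColor.notFirst,
      TwoColor.isParticle] <;> omega

theorem ThreeColor.le_hole (a : ThreeColor) : a ≤ .hole := by cases a <;> decide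

theorem TwoColor.le_hole (a : TwoColor) : a ≤ .hole := by cases a <;> decide

/-- A bond is inactive when its left end carries the weakest colour. -/
theorem abs_bulkJump_sub_le {C : Type*} [LinearOrder C] {c : C} (hc : ∀ a, a ≤ c)
    {f : Config C → ℝ} (hf : ∀ ζ, f ζ ∈ Set.Icc 0 1) (x : ℕ+) (ζ : Config C) :
    |f (bulkJump x ζ) - f ζ| ≤ neIndicator c x ζ := by
  unfold neIndicator
  split_ifs with h
  · have : bulkJump x ζ = ζ := if_neg (by rw [h, not_lt]; exact hc _)
    simp [this]
  · have h1 := hf ζ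
    have h2 := hf (bulkJump x ζ)
    rw [abs_le]
    constructor <;> linarith [h1.1, h1.2, h2.1, h2.2]

/-- The reservoir terms and all bonds inside the window cancel by symmetry. Only the bond leaving
the window remains, and it acts only if the last site of the window is not a hole. -/
theorem abs_generator_survivors_sub_le (α : ℝ) {G : ℤ → ℝ} (hG : ∀ n, G n ∈ Set.Icc 0 1) (K : ℕ)
    (ζ : Config ThreeColor) (ξ : Config TwoColor) :
    |generator α (fun ζ => G (survivors (K + 1) ζ ξ)) ζ -
        generator α (fun ξ => G (survivors (K + 1) ζ ξ)) ξ| ≤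
      neIndicator .hole (Nat.succPNat K) ζ + neIndicator .hole (Nat.succPNat K) ξ := by
  have h1 : DependsUpTo (Nat.succPNat K) (fun ζ => G (survivors (K + 1) ζ ξ)) :=
    fun _ _ h => congrArg G (survivors_congr h fun _ _ => rfl)
  have h2 : DependsUpTo (Nat.succPNat K) (fun ξ => G (survivors (K + 1) ζ ξ)) :=
    fun _ _ h => congrArg G (survivors_congr (fun _ _ => rfl) h)
  have h3 := abs_bulkJump_sub_le ThreeColor.le_hole (fun ζ => hG (survivors (K + 1) ζ ξ))
    (Nat.succPNat K) ζ
  have h4 := abs_bulkJump_sub_le TwoColor.le_hole (fun ξ => hG (survivors (K + 1) ζ ξ))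
    (Nat.succPNat K) ξ
  rw [h1.generator_eq, h2.generator_eq, survivors_reservoirJump, add_sub_add_left_eq_sub,
    ← Finset.sum_sub_distrib, Finset.sum_eq_single (Nat.succPNat K)]
  · exact (abs_sub _ _).trans (add_le_add h3 h4)
  · intro x hx hxK
    obtain ⟨i, rfl⟩ : ∃ i, x = Nat.succPNat i := ⟨x.natPred, (PNat.succPNat_natPred x).symm⟩
    have hi : i + 1 < K + 1 := by
      have := lt_of_le_of_ne (Finset.mem_Icc.1 hx).2 hxK
      rw [Nat.succPNat_lt_succPNat] at this
      omega
    rw [survivors_bulkJump hi, sub_self]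
  · simp

end DualityFunction

/-! ### Evaluating the duality function at the initial conditions -/

section Observables

/-- With no particle to insert, both deficiencies vanish. -/
theorem survivors_stepInit (K : ℕ) (ζ : Config ThreeColor) :
    survivors K ζ stepInit = ∑ i ∈ Finset.range K, (ζ (Nat.succPNat i)).isSecond := by
  have h : ∀ q : ℕ → ℤ, (∀ i, 0 ≤ q i) →
      maxPartialSum (fun i => (stepInit (Nat.succPNat i)).isParticle - q i) K = 0 := by
    intro q hq
    obtain ⟨y, -, hy⟩ := exists_maxPartialSum_eq
      (fun i => (stepInit (Nat.succPNat i)).isParticle - q i) K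
    refine le_antisymm (hy.le.trans (Finset.sum_nonpos fun i _ => ?_)) (maxPartialSum_nonneg _ _)
    simpa [stepInit, TwoColor.isParticle] using hq i
  rw [survivors, h, h]
  · ring
  · intro i; cases ζ (Nat.succPNat i) <;> decide
  · intro i; cases ζ (Nat.succPNat i) <;> decide

/-- The number of particles among the first `L` sites. -/
def particleCount (L : ℕ) (ξ : Config TwoColor) : ℤ :=
  ∑ i ∈ Finset.range L, (ξ (Nat.succPNat i)).isParticle

/-- Beyond `L` there are only holes, each able to take a particle located there; thus only the
number of particles in the first `L` sites matters, not their positions. -/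
theorem survivors_eq {a b L K : ℕ} (haL : a ≤ L) (hbL : b ≤ L) (hLK : L ≤ K)
    {ζ : Config ThreeColor}
    (ha : ∀ i, (ζ (Nat.succPNat i)).isHole = if i < a ∨ L ≤ i then 1 else 0)
    (hb : ∀ i, (ζ (Nat.succPNat i)).notFirst = if i < b ∨ L ≤ i then 1 else 0)
    (ξ : Config TwoColor) :
    survivors K ζ ξ = ∑ i ∈ Finset.range K, (ζ (Nat.succPNat i)).isSecond
      - max 0 (particleCount L ξ - a) + max 0 (particleCount L ξ - b) := by
  have h0 : ∀ i, 0 ≤ (ξ (Nat.succPNat i)).isParticle := fun i => by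
    cases ξ (Nat.succPNat i) <;> decide
  have h1 : ∀ i, (ξ (Nat.succPNat i)).isParticle ≤ 1 := fun i => by
    cases ξ (Nat.succPNat i) <;> decide
  have key : ∀ {q : ℕ → ℤ} {c : ℕ}, c ≤ L → (∀ i, q i = if i < c ∨ L ≤ i then 1 else 0) →
      maxPartialSum (fun i => (ξ (Nat.succPNat i)).isParticle - q i) K =
        max 0 (particleCount L ξ - c) := by
    intro q c hc hq
    refine maxPartialSum_sub hc hLK h0 h1 (fun i hi => ?_) (fun i hi hi' => ?_) fun i hi => ?_
    · rw [hq, if_pos (Or.inl hi)]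
    · rw [hq, if_neg (by omega)]
    · rw [hq, if_pos (Or.inr hi)]
  rw [survivors, key haL ha, key hbL hb]

theorem shockInit_succPNat (M₁ M₂ i : ℕ) : shockInit M₁ M₂ (Nat.succPNat i) =
    if i = M₁ then .second else if M₁ < i ∧ i < M₁ + M₂ + 1 then .first else .hole := by
  change (if i + 1 = M₁ + 1 then ThreeColor.second
    else if M₁ + 2 ≤ i + 1 ∧ i + 1 ≤ M₁ + M₂ + 1 then .first else .hole) = _
  split_ifs <;> first | rfl | omega

theorem shockInit'_succPNat (M₁ M₂ i : ℕ) : shockInit' M₁ M₂ (Nat.succPNat i) =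
    if M₁ ≤ i ∧ i < M₁ + M₂ + 1 then .second else .hole := by
  change (if M₁ + 1 ≤ i + 1 ∧ i + 1 ≤ M₁ + M₂ + 1 then ThreeColor.second else .hole) = _
  split_ifs <;> first | rfl | omega

/-- With `N` particles this is `1 - max 0 (N - M₁) + max 0 (N - M₁ - 1)`. -/
theorem survivors_shockInit (M₁ M₂ : ℕ) {K : ℕ} (hK : M₁ + M₂ + 1 ≤ K) (ξ : Config TwoColor) :
    survivors K (shockInit M₁ M₂) ξ =
      if particleCount (M₁ + M₂ + 1) ξ ≤ M₁ then 1 else 0 := by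
  rw [survivors_eq (a := M₁) (b := M₁ + 1) (L := M₁ + M₂ + 1) (by omega) (by omega) hK]
  · have : ∀ i, (shockInit M₁ M₂ (Nat.succPNat i)).isSecond = if i = M₁ then 1 else 0 := by
      intro i
      rw [shockInit_succPNat]
      split_ifs <;> rfl
    simp only [this]
    rw [Finset.sum_ite_eq' (Finset.range K) M₁, if_pos (by simp; omega)]
    split_ifs <;> push_cast <;> omega
  · intro i
    rw [shockInit_succPNat]
    split_ifs <;> first | rfl | omega
  · intro i
    rw [shockInit_succPNat]
    split_ifs <;> first | rfl | omega

theorem particleCount_le (L : ℕ) (ξ : Config TwoColor) : particleCount L ξ ≤ L := by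
  have : particleCount L ξ ≤ ∑ i ∈ Finset.range L, 1 := Finset.sum_le_sum fun i _ => by
    cases ξ (Nat.succPNat i) <;> decide
  simpa using this

/-- No colour is `first`, so every site is available in the second deficiency, which vanishes
because `N` is at most the number of sites. -/
theorem survivors_shockInit' (M₁ M₂ : ℕ) {K : ℕ} (hK : M₁ + M₂ + 1 ≤ K) (ξ : Config TwoColor) :
    survivors K (shockInit' M₁ M₂) ξ =
      M₂ + 1 - max 0 (particleCount (M₁ + M₂ + 1) ξ - M₁) := by
  have hcount := particleCount_le (M₁ + M₂ + 1) ξ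
  rw [survivors_eq (a := M₁) (b := M₁ + M₂ + 1) (L := M₁ + M₂ + 1) (by omega) le_rfl hK]
  · have : ∀ i, (shockInit' M₁ M₂ (Nat.succPNat i)).isSecond =
        if i ∈ Finset.Ico M₁ (M₁ + M₂ + 1) then 1 else 0 := by
      intro i
      simp only [Finset.mem_Ico]
      rw [shockInit'_succPNat]
      split_ifs <;> rfl
    simp only [this]
    rw [Finset.sum_ite_mem, Finset.inter_eq_right.2, Finset.sum_const, Nat.card_Ico]
    · push_cast at hcount ⊢
      rw [max_eq_left (a := (0 : ℤ)) (b := particleCount (M₁ + M₂ + 1) ξ - (M₁ + M₂ + 1))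
        (by omega), nsmul_eq_mul, mul_one, Nat.cast_sub (by omega)]
      push_cast
      ring
    · intro i hi
      simp only [Finset.mem_Ico, Finset.mem_range] at hi ⊢
      omega
  · intro i
    rw [shockInit'_succPNat]
    split_ifs <;> first | rfl | omega
  · intro i
    rw [shockInit'_succPNat]
    split_ifs <;> first | rfl | omega

theorem sum_isSecond_eq_card (ζ : Config ThreeColor) (K : ℕ) :
    ∑ i ∈ Finset.range K, (ζ (Nat.succPNat i)).isSecond =
      ((Finset.range K).filter fun i => ζ (Nat.succPNat i) = .second).card := by
  rw [Finset.card_filter, Nat.cast_sum]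
  refine Finset.sum_congr rfl fun i _ => ?_
  cases ζ (Nat.succPNat i) <;> simp [ThreeColor.isSecond]

theorem secondClassPosition_pos_iff (ζ : Config ThreeColor) :
    0 < secondClassPosition ζ ↔ ∃ x, ζ x = .second := by
  constructor
  · intro h
    obtain ⟨n, x, -, hx⟩ := Nat.nonempty_of_pos_sInf h
    exact ⟨x, hx⟩
  · rintro ⟨x, hx⟩
    obtain ⟨y, hy, -⟩ := Nat.sInf_mem
      (s := {n : ℕ | ∃ x : ℕ+, (x : ℕ) = n ∧ ζ x = .second}) ⟨x, x, rfl, hx⟩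
    exact y.pos.trans_eq hy

theorem numRight_second_one (ζ : Config ThreeColor) :
    numRight .second 1 ζ = {i | ζ (Nat.succPNat i) = .second}.encard := by
  rw [numRight, ← Nat.succPNat_injective.encard_image]
  congr 1
  ext x
  simp only [Set.mem_ofPred_eq, Set.mem_image]
  constructor
  · rintro ⟨-, hx⟩
    exact ⟨x.natPred, by simpa using hx, PNat.succPNat_natPred x⟩
  · rintro ⟨i, hi, rfl⟩
    exact ⟨by simp, hi⟩

-- The limit is taken at every configuration, so nothing about which configurations the process
-- reaches is needed.
open Classical in
theorem tendsto_indicator_secondClassPosition (ζ : Config ThreeColor) :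
    Tendsto (fun K : ℕ => if ∑ i ∈ Finset.range K, (ζ (Nat.succPNat i)).isSecond ≠ 0
      then (1 : ℝ) else 0) atTop (𝓝 (if 0 < secondClassPosition ζ then 1 else 0)) := by
  simp only [sum_isSecond_eq_card, ne_eq, ite_not, Nat.cast_eq_zero, Finset.card_eq_zero]
  refine tendsto_const_nhds.congr' ?_
  by_cases h : ∃ x, ζ x = .second
  · rw [if_pos ((secondClassPosition_pos_iff ζ).2 h)]
    obtain ⟨x, hx⟩ := h
    filter_upwards [eventually_gt_atTop x.natPred] with K hK
    refine (if_neg ?_).symm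
    refine Finset.Nonempty.ne_empty ⟨x.natPred, ?_⟩
    simp [hK, hx]
  · rw [if_neg (mt (secondClassPosition_pos_iff ζ).1 h)]
    push Not at h
    simp [h]

-- If there are infinitely many second class particles, the truncated counts eventually exceed `m`,
-- in agreement with `numRight` being `⊤`.
open Classical in
theorem tendsto_indicator_numRight (ζ : Config ThreeColor) (m : ℕ) :
    Tendsto (fun K : ℕ => if ∑ i ∈ Finset.range K, (ζ (Nat.succPNat i)).isSecond = m
      then (1 : ℝ) else 0) atTop (𝓝 (if numRight .second 1 ζ = m then 1 else 0)) := by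
  simp only [sum_isSecond_eq_card, Nat.cast_inj, numRight_second_one]
  refine tendsto_const_nhds.congr' ?_
  rcases Set.finite_or_infinite {i | ζ (Nat.succPNat i) = .second} with h | h
  · obtain ⟨b, hb⟩ := h.bddAbove
    filter_upwards [eventually_gt_atTop b] with K hK
    have h1 : (Finset.range K).filter (fun i => ζ (Nat.succPNat i) = .second) = h.toFinset := by
      ext i
      simp only [Finset.mem_filter, Finset.mem_range, Set.Finite.mem_toFinset, Set.mem_ofPred_eq,
        and_iff_right_iff_imp]
      exact fun hi => (hb hi).trans_lt hK
    rw [h1, h.encard_eq_coe_toFinset_card]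
    simp only [Nat.cast_inj]
  · obtain ⟨t, ht, htc⟩ := h.exists_subset_card_eq (m + 1)
    filter_upwards [eventually_gt_atTop (t.sup id)] with K hK
    rw [h.encard_eq, if_neg (by simp), if_neg]
    refine ne_of_gt (lt_of_lt_of_le (Nat.lt_succ_self m)
      (htc.symm.le.trans (Finset.card_le_card fun i hi => ?_)))
    simp only [Finset.mem_filter, Finset.mem_range]
    exact ⟨(Finset.le_sup (f := id) hi).trans_lt hK, ht hi⟩

end Observables

/-! ### Exact duality by removing the cut-off -/

section ExactDuality

variable {Ω Ω' : Type*} [MeasurableSpace Ω] [MeasurableSpace Ω'] {α : ℝ}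
  {ζ₀ : Config ThreeColor} {P : Measure Ω} {η : ℝ≥0 → Ω → Config ThreeColor}
  {P' : Measure Ω'} {ξ : ℝ≥0 → Ω' → Config TwoColor}

/-- The number of second class particles at a fixed time is determined by the process with step
initial condition. -/
theorem IsHalfLineTASEP.mean_eq_mean_step [IsProbabilityMeasure P]
    [IsProbabilityMeasure P'] (h : IsHalfLineTASEP α ζ₀ P η)
    (h' : IsHalfLineTASEP α stepInit P' ξ) {n : ℕ}
    (hζ₀ : ∀ i, n < i → ζ₀ (Nat.succPNat i) = .hole) {G : ℤ → ℝ} (hG : ∀ k, G k ∈ Set.Icc 0 1)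
    {F : Config ThreeColor → ℝ} (hF : ∀ ζ, Tendsto (fun K : ℕ =>
      G (∑ i ∈ Finset.range K, (ζ (Nat.succPNat i)).isSecond)) atTop (𝓝 (F ζ)))
    {s : Config TwoColor → ℤ} (hs : ∀ K, n < K → ∀ ξ, survivors K ζ₀ ξ = s ξ) {T : ℝ}
    (hT : 0 ≤ T) : mean P η F T = mean P' ξ (fun ξ => G (s ξ)) T := by
  have hdep : ∀ K ξ, DependsUpTo (Nat.succPNat K) (fun ζ => G (survivors (K + 1) ζ ξ)) :=
    fun K ξ _ _ h => congrArg G (survivors_congr h fun _ _ => rfl)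
  have hdep' : ∀ K ζ, DependsUpTo (Nat.succPNat K) (fun ξ => G (survivors (K + 1) ζ ξ)) :=
    fun K ζ _ _ h => congrArg G (survivors_congr (fun _ _ => rfl) h)
  -- This is the end `s = T` of the interpolation, where the two-colour process is still empty; the
  -- cut-off is removed by dominated convergence.
  have hlim : Tendsto (fun j => mean P η (fun ζ => G (survivors (n + j + 1) ζ stepInit)) T) atTop
      (𝓝 (mean P η F T)) := by
    refine tendsto_integral_of_dominated_convergence (fun _ => 1)
      (fun j => (h.integrable (hdep (n + j) stepInit) _).aestronglyMeasurable)
      (integrable_const _) (fun j => ae_of_all _ fun ω => ?_) (ae_of_all _ fun ω => ?_)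
    · rw [Real.norm_eq_abs, abs_of_nonneg (hG _).1]
      exact (hG _).2
    · simp only [survivors_stepInit]
      refine (hF _).comp (f := fun j => n + j + 1) ?_
      exact tendsto_atTop_mono (fun j => by omega : ∀ j, j ≤ n + j + 1) tendsto_id
  refine tendsto_nhds_unique hlim ?_
  rw [tendsto_iff_dist_tendsto_zero]
  -- At the other end the value is already free of the cut-off. In both processes the last site of
  -- the window, `n + j + 1`, is a non-hole with probability at most `t ^ j / j!`.
  have hbound : ∀ j, dist (mean P η (fun ζ => G (survivors (n + j + 1) ζ stepInit)) T)
      (mean P' ξ (fun ξ => G (s ξ)) T) ≤ 2 * (T ^ j / j.factorial) * T := by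
    intro j
    have hpow : ∀ t ∈ Set.Icc 0 T, t ^ j / (j.factorial : ℝ) ≤ T ^ j / j.factorial := by
      intro t ht
      have := ht.1
      have := ht.2
      gcongr
    have h1 := abs_mean_sub_mean_le_of_generator h h' (hdep (n + j)) (hdep' (n + j))
      (dependsUpTo_neIndicator ThreeColor.hole _) (dependsUpTo_neIndicator TwoColor.hole _)
      (abs_generator_survivors_sub_le α hG (n + j)) hT
      (fun t ht => (h.mean_neIndicator_le ThreeColor.le_hole hζ₀ j ht.1).trans (hpow t ht))
      (fun t ht => (h'.mean_neIndicator_le TwoColor.le_hole (n := n) (fun _ _ => rfl) j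
        ht.1).trans (hpow t ht))
    simp only [hs (n + j + 1) (by omega)] at h1
    exact h1
  refine squeeze_zero (fun _ => dist_nonneg) hbound ?_
  have := ((FloorSemiring.tendsto_pow_div_factorial_atTop T).const_mul 2).mul_const T
  simpa using this

open Classical in
theorem measureReal_eq_mean (p : Config ThreeColor → Prop) (hp : ∀ t, MeasurableSet {ω | p (η t ω)})
    (t : ℝ≥0) : P.real {ω | p (η t ω)} = mean P η (fun ζ => if p ζ then 1 else 0) t := by
  rw [mean, Real.toNNReal_coe, ← integral_indicator_one (hp t)]
  rfl

end ExactDuality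

/-! ### Word weights from the matrix relations -/

section WordWeight

variable {α : ℝ} (A : MatrixAnsatz α)

/-- A relation between words persists under multiplication by a prefix; sums in `[0, ∞]` may be
rearranged freely. -/
theorem applyWord_append_congr {l₂ l₃ l₄ : List Bool} {c : ℝ≥0∞}
    (h : ∀ i, A.applyWord l₂ i = c * (A.applyWord l₃ i + A.applyWord l₄ i)) (l : List Bool)
    (i : ℕ) : A.applyWord (l ++ l₂) i =
      c * (A.applyWord (l ++ l₃) i + A.applyWord (l ++ l₄) i) := by
  induction l generalizing i with
  | nil => exact h i
  | cons b l ih =>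
    simp only [List.cons_append, MatrixAnsatz.applyWord, ih]
    rw [← ENNReal.tsum_add, ← ENNReal.tsum_mul_left]
    exact tsum_congr fun j => by ring

theorem applyWord_true_false (l : List Bool) (i : ℕ) :
    A.applyWord (true :: false :: l) i =
      1 / 4 * (A.applyWord (true :: l) i + A.applyWord (false :: l) i) := by
  simp only [MatrixAnsatz.applyWord, MatrixAnsatz.letter, if_true, Bool.false_eq_true, if_false]
  simp only [← ENNReal.tsum_mul_left]
  rw [ENNReal.tsum_comm, ← ENNReal.tsum_add, ← ENNReal.tsum_mul_left]
  refine tsum_congr fun j => ?_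
  simp only [← mul_assoc]
  rw [ENNReal.tsum_mul_right, A.mul_rel]
  ring

theorem weight_append_true_false (l l' : List Bool) :
    A.weight (l ++ true :: false :: l') =
      1 / 4 * (A.weight (l ++ true :: l') + A.weight (l ++ false :: l')) := by
  simp only [MatrixAnsatz.weight, applyWord_append_congr A (applyWord_true_false A l') l]
  rw [← ENNReal.tsum_add, ← ENNReal.tsum_mul_left]
  exact tsum_congr fun j => by ring

theorem weight_false_cons (l : List Bool) :
    ENNReal.ofReal α * A.weight (false :: l) = 1 / 4 * A.weight l := by
  simp only [MatrixAnsatz.weight, MatrixAnsatz.applyWord, MatrixAnsatz.letter,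
    Bool.false_eq_true, if_false]
  simp only [← ENNReal.tsum_mul_left]
  rw [ENNReal.tsum_comm]
  refine tsum_congr fun j => ?_
  simp only [← mul_assoc]
  rw [ENNReal.tsum_mul_right, ← A.left_rel, ← ENNReal.tsum_mul_left]
  simp only [mul_assoc]

theorem weight_append_singleton (l : List Bool) :
    A.weight (l ++ [true]) + A.weight (l ++ [false]) = A.weight l := by
  rw [← sum_weight_append A l 1, ← (Equiv.funUnique (Fin 1) Bool).symm.sum_comp,
    Fintype.sum_bool]
  rfl

/-- The weights of all words of a given length are non-negative and sum to `1`. -/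
theorem weight_ne_top (l : List Bool) : A.weight l ≠ ∞ := by
  have h : A.weight l ≤ 1 := by
    rw [← weight_nil A, ← sum_weight_append A [] l.length]
    have := Finset.single_le_sum (f := fun m : Fin l.length → Bool =>
      A.weight ([] ++ List.ofFn m)) (fun _ _ => zero_le) (Finset.mem_univ l.get)
    simpa using this
  exact (h.trans_lt ENNReal.one_lt_top).ne

/-- The weight of a word as a real number. -/
noncomputable def wordWeight (l : List Bool) : ℝ := (A.weight l).toReal

theorem wordWeight_append_true_false (l l' : List Bool) :
    wordWeight A (l ++ true :: false :: l') =
      1 / 4 * (wordWeight A (l ++ true :: l') + wordWeight A (l ++ false :: l')) := by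
  simp [wordWeight, weight_append_true_false, ENNReal.toReal_add (weight_ne_top A _)
    (weight_ne_top A _)]

theorem wordWeight_false_cons (hα : 0 < α) (l : List Bool) :
    wordWeight A (false :: l) = 1 / 4 / α * wordWeight A l := by
  have := congrArg ENNReal.toReal (weight_false_cons A l)
  simp only [ENNReal.toReal_mul, ENNReal.toReal_ofReal hα.le, one_div, ENNReal.toReal_inv,
    ENNReal.toReal_ofNat] at this
  simp only [wordWeight]
  field_simp
  linarith

theorem wordWeight_append_singleton (l : List Bool) :
    wordWeight A (l ++ [true]) + wordWeight A (l ++ [false]) = wordWeight A l := by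
  simp only [wordWeight]
  rw [← ENNReal.toReal_add (weight_ne_top A _) (weight_ne_top A _), weight_append_singleton]

theorem wordWeight_replicate (hα : 0 < α) (k : ℕ) :
    wordWeight A (List.replicate k true) = 1 / 2 ^ k * (1 + (α - 1 / 2) / α * k) := by
  -- The weights of `1^k` and `1^k 0` determine each other: they give the weight of `1^(k+1)` by
  -- normalization, and then `DE = (D + E) / 4` gives that of `1^(k+1) 0`. The recursion starts from
  -- `⟨w|E|v⟩ = 1 / (4α)`, which is the second formula at `k = 0`.
  have h : ∀ k, wordWeight A (List.replicate k true) = 1 / 2 ^ k * (1 + (α - 1 / 2) / α * k) ∧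
      wordWeight A (List.replicate k true ++ [false]) =
        1 / 2 ^ (k + 1) * (1 + (α - 1 / 2) / α * (k - 1)) := by
    intro k
    induction k with
    | zero =>
      have h1 := wordWeight_false_cons A hα []
      have h2 : wordWeight A [] = 1 := by simp [wordWeight, weight_nil]
      simp only [List.replicate_zero, List.nil_append, h1, h2]
      constructor
      · simp
      · field_simp
        push_cast
        ring
    | succ k ih =>
      have h1 := wordWeight_append_singleton A (List.replicate k true)
      have h2 := wordWeight_append_true_false A (List.replicate k true) []
      rw [← List.replicate_succ'] at h1 h2
      have h3 : List.replicate k true ++ [true, false] = List.replicate (k + 1) true ++ [false] := by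
        simp [List.replicate_succ']
      rw [ih.1, ih.2] at h1
      have h4 : wordWeight A (List.replicate (k + 1) true) =
          1 / 2 ^ (k + 1) * (1 + (α - 1 / 2) / α * (k + 1 : ℕ)) := by
        rw [eq_sub_of_add_eq h1, pow_succ]
        push_cast
        ring
      refine ⟨h4, ?_⟩
      rw [← h3, h2, h4, ih.2, pow_succ, pow_succ]
      push_cast
      field_simp
      ring
  exact (h k).1

end WordWeight

/-! ### Run-length decomposition of a word -/

section Runs

/-- The word `1^σ₁ 0^τ₁ ⋯ 1^σ_A 0^τ_A`. -/
def ofRuns (r : List (ℕ × ℕ)) : List Bool :=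
  r.flatMap fun p => List.replicate p.1 true ++ List.replicate p.2 false

theorem replicate_append_ofRuns_runs (l : List Bool) :
    List.replicate (runs l).1 false ++ ofRuns (runs l).2 = l := by
  induction l with
  | nil => rfl
  | cons b l ih =>
    cases b
    · simp [runs, List.replicate_succ, ih]
    · conv_rhs => rw [← ih]
      simp only [runs]
      split <;> simp_all [ofRuns, List.replicate_succ]

theorem one_le_of_mem_runs (l : List Bool) : ∀ p ∈ (runs l).2, 1 ≤ p.1 := by
  induction l with
  | nil => simp [runs]
  | cons b l ih =>
    cases b
    · exact ih
    · simp only [runs]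
      split <;> rename_i heq <;> rw [heq] at ih <;> simp_all <;>
        first | exact ih.2 | exact ih

variable {L : ℕ} (η : Fin L → Bool)

/-- The suffix of the word that starts with the `i`-th cluster of ones. -/
def clusterSuffix (i : ℕ) : List Bool := ofRuns ((runs (List.ofFn η)).2.drop (i - 1))

theorem ofFn_eq_clusterSuffix :
    List.ofFn η = List.replicate (tau η 0) false ++ clusterSuffix η 1 :=
  (replicate_append_ofRuns_runs _).symm

theorem clusterSuffix_last : clusterSuffix η (numClusters η + 1) = [] := by
  simp [clusterSuffix, numClusters, ofRuns]

theorem clusterSuffix_eq {i : ℕ} (hi : 1 ≤ i) (hi' : i ≤ numClusters η) :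
    clusterSuffix η i = List.replicate (sigma η i) true ++
      (List.replicate (tau η i) false ++ clusterSuffix η (i + 1)) := by
  obtain ⟨i, rfl⟩ : ∃ j, i = j + 1 := ⟨i - 1, by omega⟩
  have hlt : i < (runs (List.ofFn η)).2.length := hi'
  simp only [clusterSuffix, sigma, tau, ofRuns, Nat.add_sub_cancel, Nat.add_eq_zero_iff,
    one_ne_zero, and_false, if_false]
  rw [List.drop_eq_getElem_cons hlt, List.getD_eq_getElem _ _ hlt, List.flatMap_cons,
    List.append_assoc]

theorem one_le_sigma {i : ℕ} (hi : 1 ≤ i) (hi' : i ≤ numClusters η) : 1 ≤ sigma η i := by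
  obtain ⟨i, rfl⟩ : ∃ j, i = j + 1 := ⟨i - 1, by omega⟩
  have hlt : i < (runs (List.ofFn η)).2.length := hi'
  have := one_le_of_mem_runs (List.ofFn η) _ (List.getElem_mem hlt)
  simpa [sigma, List.getElem?_eq_getElem hlt] using this

theorem Psi_eq {i : ℕ} (hi : i ≤ numClusters η) : Psi η i = sigma η i + Psi η (i + 1) := by
  simp only [Psi, ← Finset.Ico_add_one_right_eq_Icc]
  exact Finset.sum_eq_sum_Ico_succ_bot (by omega) _

theorem Phi_eq {i : ℕ} (hi : i ≤ numClusters η) : Phi η i = tau η i + Phi η (i + 1) := by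
  simp only [Phi, ← Finset.Ico_add_one_right_eq_Icc]
  exact Finset.sum_eq_sum_Ico_succ_bot (by omega) _

theorem Psi_last : Psi η (numClusters η + 1) = 0 := by simp [Psi]

theorem Phi_last : Phi η (numClusters η + 1) = 0 := by simp [Phi]

theorem Psi_antitone : Antitone (Psi η) := fun _ _ h =>
  Finset.sum_le_sum_of_subset (Finset.Icc_subset_Icc_left h)

theorem Phi_antitone : Antitone (Phi η) := fun _ _ h =>
  Finset.sum_le_sum_of_subset (Finset.Icc_subset_Icc_left h)

end Runs

/-! ### The DEHP-tree as a reduction of words -/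

section Tree

variable {L : ℕ} {η : Fin L → Bool}

theorem HasTwoChildren.pos {p : ℕ × ℕ} (h : HasTwoChildren η p) : 1 ≤ p.1 ∧ 1 ≤ p.2 := by
  obtain ⟨i, hi, hi', hy, -, hx⟩ := h
  refine ⟨?_, hy⟩
  have h1 := one_le_sigma η hi hi'
  have h2 := Psi_eq η hi'
  omega

theorem HasOneChild.pos {p : ℕ × ℕ} (h : HasOneChild η p) : 1 ≤ p.2 := by
  obtain ⟨i, -, -, -, h, -⟩ := h
  omega

theorem child_add_lt {p : ℕ × ℕ} {d : Direction} (h : HasChild η p d) :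
    (child p d).1 + (child p d).2 < p.1 + p.2 := by
  cases d
  · rcases h with h | h
    · have := h.pos
      simp only [child]; omega
    · have := h.pos.2
      simp only [child]; omega
  · have := HasTwoChildren.pos h
    simp only [child]; omega

/-- The directed paths from `p` to `q`. -/
def pathsTo (η : Fin L → Bool) (p q : ℕ × ℕ) : Set (List Direction) :=
  {l | IsPath η p l ∧ pathEnd p l = q}

/-- The sum of the weights of all directed paths from `p` to `q`. -/
noncomputable def pathSum (α : ℝ) (η : Fin L → Bool) (p q : ℕ × ℕ) : ℝ :=
  ∑ᶠ l ∈ pathsTo η p q, pathWeight α η p l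

theorem pathsTo_self_of_no_child {p : ℕ × ℕ} (h : ∀ d, ¬ HasChild η p d) (q : ℕ × ℕ) :
    pathsTo η p q = {l | l = [] ∧ p = q} := by
  ext l
  cases l with
  | nil => simp [pathsTo, IsPath, pathEnd]
  | cons d l => simp [pathsTo, IsPath, h d]

/-- Finiteness lets the `finsum` in `pathSum` split over the first step, and rules out its default
value `0` for infinite support. -/
theorem finite_pathsTo (p q : ℕ × ℕ) : (pathsTo η p q).Finite := by
  have h : ∀ n, ∀ p : ℕ × ℕ, p.1 + p.2 < n → ({l | IsPath η p l}).Finite := by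
    intro n
    induction n with
    | zero => intro p hp; omega
    | succ n ih =>
      intro p hp
      have hd : ∀ d, ({l | HasChild η p d ∧ IsPath η (child p d) l}).Finite := by
        intro d
        by_cases hc : HasChild η p d
        · exact (ih (child p d) (by have := child_add_lt hc; omega)).subset fun l hl => hl.2
        · simp [hc]
      refine ((Set.finite_singleton []).union (((hd .left).image (List.cons .left)).union
        ((hd .right).image (List.cons .right)))).subset fun l hl => ?_
      rcases l with _ | ⟨_ | _, l⟩
      · exact Or.inl rfl
      · exact Or.inr (Or.inl ⟨l, hl, rfl⟩)
      · exact Or.inr (Or.inr ⟨l, hl, rfl⟩)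
  exact (h _ p (Nat.lt_succ_self _)).subset fun l hl => hl.1

theorem pathSum_of_no_child {p : ℕ × ℕ} (h : ∀ d, ¬ HasChild η p d) (α : ℝ) (q : ℕ × ℕ) :
    pathSum α η p q = if p = q then 1 else 0 := by
  rw [pathSum, pathsTo_self_of_no_child h]
  split_ifs with hpq
  · simp [hpq, pathWeight]
  · simp [hpq]

theorem finsum_cons_image (α : ℝ) (p q : ℕ × ℕ) (d : Direction) :
    ∑ᶠ l ∈ List.cons d '' pathsTo η (child p d) q, pathWeight α η p l =
      edgeWeight α η p * pathSum α η (child p d) q := by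
  rw [finsum_mem_image (List.cons_injective.injOn), pathSum, mul_finsum_mem]
  rfl

theorem pathSum_of_hasTwoChildren {p q : ℕ × ℕ} (hpq : p ≠ q) (h : HasTwoChildren η p) (α : ℝ) :
    pathSum α η p q =
      1 / 4 * (pathSum α η (child p .left) q + pathSum α η (child p .right) q) := by
  have hset : pathsTo η p q = List.cons .left '' pathsTo η (child p .left) q ∪
      List.cons .right '' pathsTo η (child p .right) q := by
    ext l
    rcases l with _ | ⟨_ | _, l⟩
    · simp [pathsTo, pathEnd, hpq]
    · simp [pathsTo, pathEnd, IsPath, HasChild, h]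
    · simp [pathsTo, pathEnd, IsPath, HasChild, h]
  rw [pathSum, hset, finsum_mem_union, finsum_cons_image, finsum_cons_image, edgeWeight, if_pos h,
    mul_add]
  · rw [Set.disjoint_left]
    rintro _ ⟨l, -, rfl⟩ ⟨l', -, hl'⟩
    simp at hl'
  · exact (finite_pathsTo _ _).image _
  · exact (finite_pathsTo _ _).image _

theorem pathSum_of_hasOneChild {p q : ℕ × ℕ} (hpq : p ≠ q) (h : HasOneChild η p)
    (h' : ¬ HasTwoChildren η p) (α : ℝ) :
    pathSum α η p q = 1 / 4 / α * pathSum α η (child p .left) q := by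
  have hset : pathsTo η p q = List.cons .left '' pathsTo η (child p .left) q := by
    ext l
    rcases l with _ | ⟨_ | _, l⟩
    · simp [pathsTo, pathEnd, hpq]
    · simp [pathsTo, pathEnd, IsPath, HasChild, h]
    · simp [pathsTo, IsPath, HasChild, h']
  rw [pathSum, hset, finsum_cons_image, edgeWeight, if_neg h']

theorem no_child_zero (x : ℕ) (d : Direction) : ¬ HasChild η (x, 0) d := by
  intro h
  cases d
  · rcases h with h | h
    · exact absurd h.pos (by simp)
    · exact absurd h.pos.2 (by simp)
  · exact absurd (HasTwoChildren.pos h).2 (by simp)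

/-- The value of the tree with root `p`, if the endpoint `(k, 0)` has value `a k`. -/
noncomputable def treeValue (α : ℝ) (η : Fin L → Bool) (a : ℕ → ℝ) (p : ℕ × ℕ) : ℝ :=
  ∑ k ∈ Finset.range (Psi η 1 + 1), pathSum α η p (k, 0) * a k

theorem treeValue_zero (α : ℝ) (a : ℕ → ℝ) {x : ℕ} (hx : x ≤ Psi η 1) :
    treeValue α η a (x, 0) = a x := by
  simp only [treeValue, pathSum_of_no_child (no_child_zero x), Prod.mk.injEq, and_true,
    ite_mul, one_mul, zero_mul]
  rw [Finset.sum_ite_eq, if_pos (by simp; omega)]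

theorem treeValue_of_hasTwoChildren {x y : ℕ} (h : HasTwoChildren η (x, y)) (α : ℝ) (a : ℕ → ℝ) :
    treeValue α η a (x, y) =
      1 / 4 * (treeValue α η a (x, y - 1) + treeValue α η a (x - 1, y)) := by
  have hne : ∀ k, (x, y) ≠ (k, 0) := fun k hk => by
    have := h.pos.2
    simp_all
  simp only [treeValue, fun k => pathSum_of_hasTwoChildren (hne k) h, mul_add, add_mul,
    Finset.sum_add_distrib, Finset.mul_sum, mul_assoc]
  rfl

theorem treeValue_of_hasOneChild {x y : ℕ} (h : HasOneChild η (x, y))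
    (h' : ¬ HasTwoChildren η (x, y)) (α : ℝ) (a : ℕ → ℝ) :
    treeValue α η a (x, y) = 1 / 4 / α * treeValue α η a (x, y - 1) := by
  have hne : ∀ k, (x, y) ≠ (k, 0) := fun k hk => by
    have := h.pos
    simp_all
  simp only [treeValue, fun k => pathSum_of_hasOneChild (hne k) h h', Finset.mul_sum, mul_assoc]
  rfl

/-- The two kinds of nodes must be disjoint, since `edgeWeight` tests only for two children. A
height above `Phi η i` forces a cluster `j < i`, and `Psi η i` is at most `Psi η (j + 1)`, below the
range allowed for `j`. -/
theorem not_hasTwoChildren {i y : ℕ} (hy : Phi η i < y) : ¬ HasTwoChildren η (Psi η i, y) := by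
  rintro ⟨j, hj, hj', -, hyj, hx⟩
  simp only at hyj hx
  have hji : j + 1 ≤ i := by
    by_contra hcon
    have := Phi_antitone η (show i ≤ j by omega)
    omega
  have h1 := Psi_antitone η hji
  have h2 := Psi_eq η hj'
  have h3 := one_le_sigma η hj hj'
  omega

/-- The column `x` lies in the range of some earlier cluster, whose `Phi` is at least `Phi η (i -
1)`. -/
theorem hasTwoChildren_of_lt {i x y : ℕ} (hi : i ≤ numClusters η + 1) (hy : 1 ≤ y)
    (hyi : y ≤ Phi η (i - 1)) (hx : Psi η i < x) (hx' : x ≤ Psi η 1) :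
    HasTwoChildren η (x, y) := by
  induction i with
  | zero =>
    have := Psi_antitone η (Nat.zero_le 1)
    omega
  | succ i ih =>
    rcases Nat.eq_zero_or_pos i with rfl | hi0
    · simp only [zero_add] at hx; omega
    rcases le_or_gt x (Psi η i) with h | h
    · refine ⟨i, hi0, by omega, hy, hyi, ?_⟩
      rcases h.eq_or_lt with h | h
      · exact Or.inl h
      · exact Or.inr ⟨hx, h⟩
    · exact ih (by omega) (hyi.trans (Phi_antitone η (by omega))) h

variable {α : ℝ} (A : MatrixAnsatz α)

/-- The node `(Psi η i + d, Phi η i + e)` stands for the word `1^d 0^e` followed by the clusters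
from `i` on. If `d, e > 0`, its children come from replacing the middle `10` by `1` or by `0`; if `d
= 0`, a leading zero is absorbed by `⟨w|`. -/
theorem treeValue_eq_wordWeight_of_base (hα : 0 < α) {i : ℕ} (hi : 1 ≤ i)
    (hi' : i ≤ numClusters η + 1)
    (hbase : ∀ d, Psi η i + d ≤ Psi η 1 →
      treeValue α η (fun k => wordWeight A (List.replicate k true)) (Psi η i + d, Phi η i) =
        wordWeight A (List.replicate d true ++ clusterSuffix η i))
    (e : ℕ) (he : Phi η i + e ≤ Phi η (i - 1)) (d : ℕ) (hd : Psi η i + d ≤ Psi η 1) :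
    treeValue α η (fun k => wordWeight A (List.replicate k true)) (Psi η i + d, Phi η i + e) =
      wordWeight A (List.replicate d true ++ (List.replicate e false ++ clusterSuffix η i)) := by
  induction e generalizing d with
  | zero => exact hbase d hd
  | succ e ihe =>
    induction d with
    | zero =>
      have h1 : HasOneChild η (Psi η i + 0, Phi η i + (e + 1)) := ⟨i, hi, hi', rfl, by omega, he⟩
      rw [treeValue_of_hasOneChild h1 (not_hasTwoChildren (by omega))]
      have h2 := ihe (by omega) 0 hd
      rw [show Phi η i + (e + 1) - 1 = Phi η i + e by omega, h2]
      exact (wordWeight_false_cons A hα _).symm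
    | succ d ihd =>
      rw [treeValue_of_hasTwoChildren
        (hasTwoChildren_of_lt hi' (by omega) he (by omega) hd)]
      have h1 := ihe (by omega) (d + 1) hd
      have h2 := ihd (by omega)
      rw [show Phi η i + (e + 1) - 1 = Phi η i + e by omega,
        show Psi η i + (d + 1) - 1 = Psi η i + d by omega, h1, h2]
      have h3 := wordWeight_append_true_false A (List.replicate d true)
        (List.replicate e false ++ clusterSuffix η i)
      simp only [List.replicate_succ', List.append_assoc, List.cons_append, List.nil_append] at h3 ⊢
      rw [← List.cons_append, ← List.replicate_succ, List.replicate_succ', List.append_assoc,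
        List.cons_append, List.nil_append] at h3
      rw [← h3]

/-- Downward induction on the cluster: the ones of cluster `i` join the prefix `1^d`, so the same
node is read as `1^(d + σ_i) 0^τ_i` in front of cluster `i + 1`. -/
theorem treeValue_eq_wordWeight (hα : 0 < α) {i d : ℕ} (hi : 1 ≤ i)
    (hi' : i ≤ numClusters η + 1) (hd : Psi η i + d ≤ Psi η 1) :
    treeValue α η (fun k => wordWeight A (List.replicate k true)) (Psi η i + d, Phi η i) =
      wordWeight A (List.replicate d true ++ clusterSuffix η i) := by
  obtain ⟨n, hn⟩ : ∃ n, i + n = numClusters η + 1 := ⟨numClusters η + 1 - i, by omega⟩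
  induction n generalizing i d with
  | zero =>
    obtain rfl : i = numClusters η + 1 := by omega
    rw [Phi_last, treeValue_zero _ _ hd, Psi_last, clusterSuffix_last, zero_add, List.append_nil]
  | succ n ih =>
    have h1 := Psi_eq η (i := i) (by omega)
    have h2 := Phi_eq η (i := i) (by omega)
    have h3 := treeValue_eq_wordWeight_of_base A hα (i := i + 1) (by omega) (by omega)
      (fun d hd => ih (by omega) (by omega) hd (by omega)) (tau η i)
      (by rw [Nat.add_sub_cancel]; omega) (d + sigma η i) (by omega)
    rw [show Psi η i + d = Psi η (i + 1) + (d + sigma η i) by omega,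
      show Phi η i = Phi η (i + 1) + tau η i by omega, h3, clusterSuffix_eq η hi (by omega),
      List.replicate_add, List.append_assoc]

/-- The root is the node of the whole word, with `i = 1`, `d = 0` and `e = τ_0`. As the left side
does not involve `A`, every solution of the relations gives the same weights. -/
theorem treeFormula_eq_toReal_weight (hα : 0 < α) :
    treeFormula α η = (A.weight (List.ofFn η)).toReal := by
  have h1 : Phi η 0 = tau η 0 + Phi η 1 := Phi_eq η (Nat.zero_le _)
  have h2 := treeValue_eq_wordWeight_of_base A hα (η := η) (i := 1) le_rfl (by omega)
    (fun d hd => treeValue_eq_wordWeight A hα le_rfl (by omega) hd) (tau η 0)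
    (by rw [Nat.sub_self]; omega) 0 le_rfl
  rw [← wordWeight, ofFn_eq_clusterSuffix]
  refine Eq.trans ?_ h2
  rw [show Phi η 1 + tau η 0 = Phi η 0 by rw [h1]; omega]
  refine Finset.sum_congr rfl fun k _ => ?_
  beta_reduce
  rw [wordWeight_replicate A hα]
  simp only [Z, nodeZ, pathSum, pathsTo, add_zero, Set.mem_ofPred_eq]
  ring

end Tree

/-! ### Passing to the limit in time -/

section Limit

variable {Ω Ω' : Type*} [MeasurableSpace Ω] [MeasurableSpace Ω'] {α : ℝ}
  {P : Measure Ω} [IsProbabilityMeasure P] {P' : Measure Ω'} [IsProbabilityMeasure P']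

/-- Cylinders are clopen, so their frontier is null and convergence in law gives convergence of
their probabilities. -/
theorem tendsto_wordCylinder {hα : 1 / 2 < α} {hα' : α < 1} {X : ℝ≥0 → Ω → ℕ+ → Bool}
    (h : TendstoInDistribution X atTop (id : (ℕ+ → Bool) → ℕ+ → Bool) (fun _ => P)
      (stationaryMeasure α hα hα' : Measure (ℕ+ → Bool))) {L : ℕ} (w : Fin L → Bool) :
    Tendsto (fun t => P.real {ω | X t ω ∈ wordCylinder w}) atTop (𝓝 (treeFormula α w)) := by
  obtain ⟨A, hA⟩ := stationaryMeasure_spec α hα hα'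
  have hC := isClopen_wordCylinder w
  have h1 := ProbabilityMeasure.tendsto_measure_of_null_frontier_of_tendsto' h.tendsto
    (E := wordCylinder w) (by rw [hC.frontier_eq]; simp)
  simp only [ProbabilityMeasure.coe_mk, Measure.map_id, hA] at h1
  have h2 := (ENNReal.tendsto_toReal (weight_ne_top A (List.ofFn w))).comp h1
  rw [← treeFormula_eq_toReal_weight A (by linarith)] at h2
  refine h2.congr fun t => ?_
  rw [Function.comp_apply, Measure.map_apply_of_aemeasurable (h.forall_aemeasurable t)
    (measurableSet_wordCylinder w)]
  rfl

theorem particleCount_eq_numOnes {L : ℕ} {ξ : Config TwoColor} {w : Fin L → Bool}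
    (h : occupation ξ ∈ wordCylinder w) : particleCount L ξ = numOnes w := by
  rw [particleCount, numOnes, Finset.card_filter, Nat.cast_sum, Finset.sum_range]
  refine Finset.sum_congr rfl fun i _ => ?_
  rw [← h i, occupation]
  cases ξ (Nat.succPNat i) <;> simp [TwoColor.isParticle]

/-- The law of the number of particles among the first `L` sites converges. -/
theorem IsHalfLineTASEP.tendsto_mean_particleCount {hα : 1 / 2 < α} {hα' : α < 1}
    {ξ : ℝ≥0 → Ω → Config TwoColor} (hξ : IsHalfLineTASEP α stepInit P ξ)
    (h : TendstoInDistribution (fun (t : ℝ≥0) ω => occupation (ξ t ω)) atTop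
      (id : (ℕ+ → Bool) → ℕ+ → Bool) (fun _ => P)
      (stationaryMeasure α hα hα' : Measure (ℕ+ → Bool))) (L : ℕ) (g : ℤ → ℝ) :
    Tendsto (fun t : ℝ≥0 => mean P ξ (fun ζ => g (particleCount L ζ)) t) atTop
      (𝓝 (∑ w : Fin L → Bool, g (numOnes w) * treeFormula α w)) := by
  classical
  have hsum : ∀ ζ : Config TwoColor, g (particleCount L ζ) = ∑ w : Fin L → Bool,
      g (numOnes w) * if occupation ζ ∈ wordCylinder w then 1 else 0 := by
    intro ζ
    rw [Finset.sum_eq_single fun i : Fin L => occupation ζ (Nat.succPNat i)]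
    · have hmem : occupation ζ ∈ wordCylinder fun i : Fin L => occupation ζ (Nat.succPNat i) :=
        fun i => rfl
      rw [if_pos hmem, mul_one, particleCount_eq_numOnes hmem]
    · intro w _ hw
      rw [if_neg fun hmem => hw (funext fun i => (hmem i).symm), mul_zero]
    · simp
  have hocc : Measurable occupation := measurable_pi_lambda _ fun x =>
    (Measurable.of_discrete (f := fun c : TwoColor => decide (c = .particle))).comp
      (measurable_pi_apply x)
  have hset : ∀ (t : ℝ≥0) (w : Fin L → Bool),
      MeasurableSet {ω | occupation (ξ t ω) ∈ wordCylinder w} := fun t w =>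
    hocc.comp (hξ.measurable t) (measurableSet_wordCylinder w)
  have hmean : ∀ t : ℝ≥0, mean P ξ (fun ζ => g (particleCount L ζ)) t = ∑ w : Fin L → Bool,
      g (numOnes w) * P.real {ω | occupation (ξ t ω) ∈ wordCylinder w} := by
    intro t
    have hind : ∀ w : Fin L → Bool, (fun ω => if occupation (ξ t ω) ∈ wordCylinder w
        then (1 : ℝ) else 0) = {ω | occupation (ξ t ω) ∈ wordCylinder w}.indicator 1 :=
      fun w => rfl
    simp only [mean, Real.toNNReal_coe, hsum]
    rw [integral_finsetSum]
    · refine Finset.sum_congr rfl fun w _ => ?_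
      rw [integral_const_mul, hind, integral_indicator_one (hset t w)]
    · intro w _
      refine Integrable.const_mul ?_ _
      rw [hind]
      exact (integrable_const (1 : ℝ)).indicator (hset t w)
  simp only [hmean]
  exact tendsto_finsetSum _ fun w _ => (tendsto_wordCylinder h w).const_mul _

theorem measurable_sum_isSecond (G : ℤ → ℝ) (K : ℕ) : Measurable fun ζ : Config ThreeColor =>
    G (∑ i ∈ Finset.range K, (ζ (Nat.succPNat i)).isSecond) :=
  (Measurable.of_discrete (f := G)).comp (Finset.measurable_fun_sum _ fun _ _ =>
    (Measurable.of_discrete (f := ThreeColor.isSecond)).comp (measurable_pi_apply _))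

open Classical in
/-- The limit of the probability of an event that is determined by the number of second class
particles. -/
theorem IsHalfLineTASEP.tendsto_measureReal {hα : 1 / 2 < α} {hα' : α < 1}
    {ζ₀ : Config ThreeColor} {η : ℝ≥0 → Ω → Config ThreeColor} (hη : IsHalfLineTASEP α ζ₀ P η)
    {ξ : ℝ≥0 → Ω' → Config TwoColor} (hξ : IsHalfLineTASEP α stepInit P' ξ)
    (hconj : TendstoInDistribution (fun (t : ℝ≥0) ω => occupation (ξ t ω)) atTop
      (id : (ℕ+ → Bool) → ℕ+ → Bool) (fun _ => P')
      (stationaryMeasure α hα hα' : Measure (ℕ+ → Bool))) {n L : ℕ}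
    (hζ₀ : ∀ i, n < i → ζ₀ (Nat.succPNat i) = .hole) {q : ℤ → Prop}
    {p : Config ThreeColor → Prop} (hp : ∀ ζ, Tendsto (fun K : ℕ =>
      if q (∑ i ∈ Finset.range K, (ζ (Nat.succPNat i)).isSecond) then (1 : ℝ) else 0) atTop
      (𝓝 (if p ζ then 1 else 0)))
    {s : ℤ → ℤ} (hs : ∀ K, n < K → ∀ ξ, survivors K ζ₀ ξ = s (particleCount L ξ)) :
    Tendsto (fun t : ℝ≥0 => P.real {ω | p (η t ω)}) atTop
      (𝓝 (∑ w : Fin L → Bool, if q (s (numOnes w)) then treeFormula α w else 0)) := by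
  -- The event is measurable because its indicator is a pointwise limit of functions of finitely
  -- many sites.
  have hpm : Measurable fun ζ : Config ThreeColor => if p ζ then (1 : ℝ) else 0 :=
    measurable_of_tendsto_metrizable
      (fun K => measurable_sum_isSecond (fun k => if q k then 1 else 0) K) (tendsto_pi_nhds.2 hp)
  have hps : MeasurableSet {ζ | p ζ} := by
    convert hpm (measurableSet_singleton 1) using 1
    ext ζ
    by_cases h : p ζ <;> simp [h]
  have hlim := hξ.tendsto_mean_particleCount hconj L fun k => if q (s k) then 1 else 0
  simp only [ite_mul, one_mul, zero_mul] at hlim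
  refine hlim.congr fun t => ?_
  rw [measureReal_eq_mean p fun t => hη.measurable t hps]
  exact (hη.mean_eq_mean_step hξ hζ₀ (G := fun k => if q k then 1 else 0)
    (fun k => by split_ifs <;> simp) hp hs t.2).symm

theorem sum_wordsWithOnes_range (L M : ℕ) (f : (Fin L → Bool) → ℝ) :
    ∑ n ∈ Finset.range M, ∑ w ∈ wordsWithOnes L n, f w =
      ∑ w, if numOnes w < M then f w else 0 := by
  simp only [wordsWithOnes, Finset.sum_filter]
  rw [Finset.sum_comm]
  simp [Finset.sum_ite_eq]

end Limit

end HalfLineTASEP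

theorem theorem4p8
    {Ω₀ Ω₁ Ω₂ : Type*} [MeasurableSpace Ω₀] [MeasurableSpace Ω₁] [MeasurableSpace Ω₂]
    (P₀ : Measure Ω₀) (P₁ : Measure Ω₁) (P₂ : Measure Ω₂)
    [IsProbabilityMeasure P₀] [IsProbabilityMeasure P₁] [IsProbabilityMeasure P₂]
    (α : ℝ) (hα : 1 / 2 < α) (hα' : α < 1)
    (M₁ M₂ : ℕ) (hM₁ : 0 < M₁) (hM₂ : 0 < M₂)
    -- the process with step initial condition, and its conjectured convergence in law
    (ηstep : ℝ≥0 → Ω₀ → Config TwoColor)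
    (hstep : IsHalfLineTASEP α stepInit P₀ ηstep)
    (hconj : TendstoInDistribution (fun (t : ℝ≥0) ω => occupation (ηstep t ω)) atTop
      (id : (ℕ+ → Bool) → ℕ+ → Bool) (fun _ => P₀)
      (stationaryMeasure α hα hα' : Measure (ℕ+ → Bool)))
    -- the two processes with shock initial conditions
    (η : ℝ≥0 → Ω₁ → Config ThreeColor)
    (hη : IsHalfLineTASEP α (shockInit M₁ M₂) P₁ η)
    (η' : ℝ≥0 → Ω₂ → Config ThreeColor)
    (hη' : IsHalfLineTASEP α (shockInit' M₁ M₂) P₂ η') :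
    Tendsto (fun t : ℝ≥0 => P₁.real {ω | 0 < secondClassPosition (η t ω)}) atTop
      (𝓝 (∑ n ∈ Finset.range (M₁ + 1), ∑ w ∈ wordsWithOnes (M₁ + M₂ + 1) n, treeFormula α w)) ∧
    ∀ m : ℕ, m ≤ M₂ →
      Tendsto (fun t : ℝ≥0 => P₂.real {ω | numRight .second 1 (η' t ω) = m}) atTop
        (𝓝 (∑ w ∈ wordsWithOnes (M₁ + M₂ + 1) (M₁ + M₂ + 1 - m), treeFormula α w)) := by
  classical
  constructor
  · have h := hη.tendsto_measureReal hstep hconj (n := M₁ + M₂) (L := M₁ + M₂ + 1)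
      (q := fun k => k ≠ 0) (p := fun ζ => 0 < secondClassPosition ζ)
      (s := fun k => if k ≤ M₁ then 1 else 0)
      (fun i hi => by
        rw [shockInit_succPNat, if_neg (by omega), if_neg (by omega)])
      (fun ζ => by convert tendsto_indicator_secondClassPosition ζ)
      (fun K hK ξ => survivors_shockInit M₁ M₂ hK ξ)
    rw [sum_wordsWithOnes_range]
    convert h using 5 with w
    simp only [ne_eq, ite_eq_right_iff, one_ne_zero, imp_false, not_not, Nat.cast_le,
      Nat.lt_succ_iff]
  · intro m hm
    have h := hη'.tendsto_measureReal hstep hconj (n := M₁ + M₂) (L := M₁ + M₂ + 1)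
      (q := fun k => k = m) (p := fun ζ => numRight .second 1 ζ = m)
      (s := fun k => M₂ + 1 - max 0 (k - M₁))
      (fun i hi => by rw [shockInit'_succPNat, if_neg (by omega)])
      (fun ζ => by convert tendsto_indicator_numRight ζ m)
      (fun K hK ξ => survivors_shockInit' M₁ M₂ hK ξ)
    rw [wordsWithOnes, Finset.sum_filter]
    convert h using 5 with w
    -- Since `m ≤ M₂`, the equation `M₂ + 1 - max 0 (N - M₁) = m` forces `N > M₁`, hence `N = M₁ +
    -- M₂ + 1 - m`, and the natural subtraction does not truncate.
    omega
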